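/- Let $F(\cdot;\xi):\mathbb{R}^d\to\mathbb{R}$ ($d\ge 1$) be a random function with $\xi\sim\mathcal D$, let $f(x)=\mathbb{E}_{\xi}[F(x;\xi)]$ (finite for every $x$), and let $L,\sigma>0$. For $\mu>0$ let $f_\mu(x)=\mathbb{E}_{u}[f(x+\mu u)]$ with $u$ uniform on the unit ball, and let $\hat\nabla F(x;\xi,u)=\frac{F(x+\mu u;\xi)-F(x;\xi)}{\mu/d}\,u$, which costs two function queries. Assume: (i) every $F(\cdot;\xi)$ is differentiable with $\|\nabla F(x;\xi)-\nabla F(x';\xi)\|\le L\|x-x'\|$ for all $x,x'\in\mathbb{R}^d$; (ii) $f^*=\inf_x f(x)>-\infty$; (iii) $\mathbb{E}\|\hat\nabla F(x;\xi,u)-\nabla f_\mu(x)\|^2\le\sigma^2$ for all $x$, where $\xi\sim\mathcal D$ and, independently, $u$ is uniform on the unit sphere. The Acc-ZOM algorithm in the unconstrained case $\mathcal X=\mathbb{R}^d$ starts at a point $x_1$, draws independent pairs $(\xi_t,u_t)$, where $\xi_t\sim\mathcal D$ and $u_t$ is independent of $\xi_t$ and uniform on the unit sphere, sets $v_1=\hat\nabla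 F(x_1;\xi_1,u_1)$, and for $t=1,\dots,T$ ($T\ge1$) $$x_{t+1}=x_t-\gamma\eta_t v_t,\qquad \eta_t=\frac{k}{(m+t)^{1/3}},\qquad \alpha_{t+1}=c\,\eta_t^2,$$ $$v_{t+1}=\hat\nabla F(x_{t+1};\xi_{t+1},u_{t+1})+(1-\alpha_{t+1})\big[v_t-\hat\nabla F(x_t;\xi_{t+1},u_{t+1})\big].$$ Its output is $x_\zeta$, with $\zeta$ uniform on $\{1,\dots,T\}$ and independent of the samples. Suppose that the real parameters satisfy $$0<\gamma\le\min\Big(\frac{m^{1/3}}{2Lk},\frac{1}{2\sqrt{6d}\,L}\Big),\quad c\ge\frac{2}{3k^3}+\frac54,\quad k>0,\quad m\ge\max\big(2,k^3,(ck)^3\big),\quad 0<\mu\le\frac{1}{d(m+T)^{2/3}}.$$ (a) Then $$\frac1T\sum_{t=1}^T\mathbb{E}\|\nabla f(x_t)\|\le\frac{\sqrt{2M}\,m^{1/6}}{T^{1/2}}+\frac{\sqrt{2M}}{T^{1/3}}+\frac{L}{2(m+T)^{2/3}},$$ where $M=\frac{f_\mu(x_1)-f^*}{k\gamma}+\frac{m^{1/3}\sigma^2}{k^2}+\frac{9L^2}{4k^2}+2k^2c^2\sigma^2\ln(m+T)$.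 (b) Consequently the query complexity of finding an $\epsilon$-stationary point is $\tilde O(d^{3/4}\epsilon^{-3})$ when $\gamma$ is of order $1/\sqrt d$: for all $L,\sigma,a>0$ and $\Delta,k,m,c$ there are $C>0$ and $p\in\mathbb{N}$ such that for all $d\ge1$ and $\epsilon\in(0,1)$ there is $T\ge1$ with the following property. For every problem and all parameters as above with $f(x_1)-f^*\le\Delta$ and $\gamma\ge a/\sqrt d$, the algorithm makes at most $C\,d^{3/4}\epsilon^{-3}\ln(2+d/\epsilon)^p$ function queries in its $T$ iterations, and $\mathbb{E}\|\nabla f(x_\zeta)\|\le\epsilon$. -/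

import Mathlib

open MeasureTheory ProbabilityTheory

noncomputable section

namespace AccZOM

/-- The decision space `ℝ^d` with its Euclidean norm. -/
abbrev Vec (d : ℕ) : Type := EuclideanSpace ℝ (Fin d)

/-- The uniform distribution over the unit sphere of `ℝ^d`: the surface measure, normalised, and
seen as a measure on `ℝ^d`. -/
def sphereUniform (d : ℕ) : Measure (Vec d) :=
  Measure.map Subtype.val
    (ProbabilityTheory.cond (Measure.toSphere (volume : Measure (Vec d))) Set.univ)

/-- The uniform distribution over the unit ball of `ℝ^d`. -/
def ballUniform (d : ℕ) : Measure (Vec d) :=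
  ProbabilityTheory.cond (volume : Measure (Vec d)) (Metric.closedBall 0 1)

section Problem

variable {d : ℕ} {Ξ : Type*}

/-- The objective `f(x) = E_{ξ ∼ D}[F(x; ξ)]`. -/
def objective [MeasurableSpace Ξ] (F : Vec d → Ξ → ℝ) (D : Measure Ξ) (x : Vec d) : ℝ :=
  ∫ s, F x s ∂D

/-- The smooth approximation `f_μ(x) = E_{u ∼ U_B}[f(x + μ u)]` of a function `f`. -/
def smoothing (μ : ℝ) (f : Vec d → ℝ) (x : Vec d) : ℝ :=
  ∫ u, f (x + μ • u) ∂(ballUniform d)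

/-- A value together with the number of queries to the stochastic function value oracle that
were spent on computing it. -/
structure Counted (α : Type*) where
  val : α
  queries : ℕ

/-- One query to the stochastic function value oracle. -/
def oracle (F : Vec d → Ξ → ℝ) (x : Vec d) (s : Ξ) : Counted ℝ :=
  ⟨F x s, 1⟩

/-- The uniform smoothing gradient estimator
`(F(x + μ u; ξ) - F(x; ξ)) / (μ / d) • u`, computed from oracle answers. -/
def zoGrad (F : Vec d → Ξ → ℝ) (μ : ℝ) (x : Vec d) (s : Ξ) (u : Vec d) : Counted (Vec d) :=
  let a := oracle F (x + μ • u) s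
  let b := oracle F x s
  ⟨((a.val - b.val) / (μ / d)) • u, a.queries + b.queries⟩

/-- The step size `η_t = k / (m + t)^{1/3}`. -/
def stepSize (k m : ℝ) (t : ℕ) : ℝ := k / (m + t) ^ ((1 : ℝ) / 3)

/-- The state `(x_t, v_t)` of the algorithm, with the number of oracle queries made so far. -/
structure State (d : ℕ) where
  x : Vec d
  v : Vec d
  queries : ℕ

/-- Initialization: `x_1` is given and `v_1` is the estimator at `x_1`. -/
def initState (F : Vec d → Ξ → ℝ) (μ : ℝ) (x₁ : Vec d) (s : Ξ) (u : Vec d) : State d :=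
  let g := zoGrad F μ x₁ s u
  ⟨x₁, g.val, g.queries⟩

/-- Iteration `t` in the unconstrained case, from `(x_t, v_t)` to `(x_{t+1}, v_{t+1})`, with the
fresh sample `s = ξ_{t+1}` and the fresh direction `u = u_{t+1}`, both of which are used in the two
estimators:
`x_{t+1} = x_t - γ η_t v_t`, `α_{t+1} = c η_t²`,
`v_{t+1} = ĝ(x_{t+1}; ξ_{t+1}) + (1 - α_{t+1}) (v_t - ĝ(x_t; ξ_{t+1}))`. -/
def step (F : Vec d → Ξ → ℝ) (γ k m c μ : ℝ) (t : ℕ) (st : State d) (s : Ξ) (u : Vec d) :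
    State d :=
  let η := stepSize k m t
  let x' := st.x - (γ * η) • st.v
  let α := c * η ^ 2
  let g' := zoGrad F μ x' s u
  let g := zoGrad F μ st.x s u
  ⟨x', g'.val + (1 - α) • (st.v - g.val), st.queries + g'.queries + g.queries⟩

/-- The state after `n` iterations, which holds `(x_{n+1}, v_{n+1})`. The samples
`ξ_1, ξ_2, …` and the directions `u_1, u_2, …` are numbered from `1`. -/
def run (F : Vec d → Ξ → ℝ) (γ k m c μ : ℝ) (x₁ : Vec d) (ξ : ℕ → Ξ) (u : ℕ → Vec d) :
    ℕ → State d
  | 0 => initState F μ x₁ (ξ 1) (u 1)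
  | n + 1 => step F γ k m c μ (n + 1) (run F γ k m c μ x₁ ξ u n) (ξ (n + 2)) (u (n + 2))

/-- The iterate `x_t`, for `t ≥ 1`. -/
def iterate (F : Vec d → Ξ → ℝ) (γ k m c μ : ℝ) (x₁ : Vec d) (ξ : ℕ → Ξ) (u : ℕ → Vec d)
    (t : ℕ) : Vec d :=
  (run F γ k m c μ x₁ ξ u (t - 1)).x

/-- The standing assumptions on the stochastic problem on `ℝ^d` with component function `F`,
data distribution `D` and smoothing parameter `μ`. -/
structure Assumptions [MeasurableSpace Ξ] (F : Vec d → Ξ → ℝ) (D : Measure Ξ) (L σ μ : ℝ) :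
    Prop where
  L_pos : 0 < L
  σ_pos : 0 < σ
  /-- `f(x) = E[F(x; ξ)]` makes sense for every `x`. -/
  measurable : ∀ x, Measurable (F x)
  integrable : ∀ x, Integrable (F x) D
  /-- every component function is `L`-smooth. -/
  differentiable : ∀ s, Differentiable ℝ (fun x => F x s)
  smooth : ∀ s x x',
    ‖gradient (fun y => F y s) x - gradient (fun y => F y s) x'‖ ≤ L * ‖x - x'‖
  /-- `f` is bounded from below. -/
  bddBelow : BddBelow (Set.range (objective F D))
  /-- `E ‖ĝ(x; ξ) - ∇ f_μ(x)‖² ≤ σ²` for every `x`, the mean being over `ξ` and `u`. -/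
  variance : ∀ x,
    ∫⁻ z, ‖(zoGrad F μ x z.1 z.2).val - gradient (smoothing μ (objective F D)) x‖ₑ ^ 2
      ∂(D.prod (sphereUniform d)) ≤ ENNReal.ofReal (σ ^ 2)

/-- The random variables drawn in `T` iterations: the pairs `(ξ_t, u_t)`, `1 ≤ t ≤ T + 1`, are
independent, and in each of them `ξ_t ∼ D` and `u_t ∼ Unif(sphere)` are independent. -/
structure Sampling [MeasurableSpace Ξ] (D : Measure Ξ) {Ω : Type*} [MeasurableSpace Ω]
    (P : Measure Ω) (T : ℕ) (ξ : ℕ → Ω → Ξ) (u : ℕ → Ω → Vec d) : Prop where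
  hasLaw : ∀ t ∈ Set.Icc 1 (T + 1),
    HasLaw (fun ω => (ξ t ω, u t ω)) (D.prod (sphereUniform d)) P
  indep : iIndepFun (fun (t : Set.Icc 1 (T + 1)) ω => (ξ t ω, u t ω)) P

/-- The constant
`M = (f_μ(x_1) - f^*) / (k γ) + m^{1/3} σ² / k² + 9 L² / (4 k²) + 2 k² c² σ² ln (m + T)`,
where `f^* = inf f`. -/
def boundConst [MeasurableSpace Ξ] (F : Vec d → Ξ → ℝ) (D : Measure Ξ)
    (L σ γ k m c μ : ℝ) (x₁ : Vec d) (T : ℕ) : ℝ :=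
  (smoothing μ (objective F D) x₁ - ⨅ x, objective F D x) / (k * γ)
    + m ^ ((1 : ℝ) / 3) * σ ^ 2 / k ^ 2 + 9 * L ^ 2 / (4 * k ^ 2)
    + 2 * k ^ 2 * c ^ 2 * σ ^ 2 * Real.log (m + T)

end Problem

/-- The conditions on the parameters of the algorithm. -/
structure Admissible (d T : ℕ) (L γ k m c μ : ℝ) : Prop where
  γ_pos : 0 < γ
  γ_le : γ ≤ min (m ^ ((1 : ℝ) / 3) / (2 * L * k)) (1 / (2 * √(6 * d) * L))
  c_ge : 2 / (3 * k ^ 3) + 5 / 4 ≤ c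
  k_pos : 0 < k
  m_ge : max 2 (max (k ^ 3) ((c * k) ^ 3)) ≤ m
  μ_pos : 0 < μ
  μ_le : μ ≤ 1 / (d * (m + T) ^ ((2 : ℝ) / 3))

end AccZOM

end

universe u v

open AccZOM

/-! The algorithm is a recursive momentum method for `f_μ`, and the proof is a Lyapunov argument.
The smoothed objective enters because the two-point estimator is exactly unbiased for `∇f_μ`: by the
divergence theorem on the unit ball (`integral_sphereUniform_mul_inner`), `(d/μ) E[f(x + μu) u]`
over the sphere equals `E[∇f(x + μu)]` over the ball. Passing back to `f` costs at most `Lμd/2` in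
the gradient, which is the last term of the bound.

Let `e = v_t - ∇f_μ(x_t)`. The two estimators of an iteration share one sample, so the next error is
`(1 - α) e` plus centred noise: `α` times the estimator noise, and `1 - α` times the centred
difference of the estimators at consecutive points. The second moment of that difference is of order
`d L² ‖x_{t+1} - x_t‖²`, up to a smoothing term, and not of order `d²`, because `E⟨a, u⟩² = ‖a‖²/d`
on the sphere. Hence `γ` of order `1/√d` is small enough.

The Lyapunov function `f_μ(x) - f^* + (3γ/4η)‖e‖²` decreases on average
(`Assumptions.integral_potential_step_le`). Smooth descent yields `-γη/2 ‖∇f_μ‖² - γη/4 ‖v‖² + γη/2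
‖e‖²`. The error recursion adds at most `-15/16 γη‖e‖² + 3/16 γη‖v‖²`, so the terms in `e` and `v`
can be dropped. What remains is summable up to a logarithm, since `η³` is of order `1/(m + t)`.
Dividing by the smallest step size gives mean squared gradient at most `2M (m + T)^{1/3} / T`, and a
square root gives (a).

For (b), `1/γ ≤ √d/a` makes `M` of order `√d` up to a logarithm. The bound is then of order `d^{1/4}
T^{-1/3}`, and `T` of order `d^{3/4} ε^{-3}` suffices, up to logarithms; each iteration costs four
queries. -/

noncomputable section

namespace AccZOM

/-! ### Polar coordinates and the divergence theorem on the unit ball -/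

section Divergence

variable {E : Type*} [NormedAddCommGroup E] [MeasurableSpace E] [BorelSpace E]

/-- Integration in polar coordinates. -/
theorem integral_eq_integral_Ioi_toSphere [NormedSpace ℝ E] [FiniteDimensional ℝ E] [Nontrivial E]
    (ν : Measure E) [ν.IsAddHaarMeasure] {g : E → ℝ} (hg : Integrable g ν) :
    ∫ x, g x ∂ν = ∫ r in Set.Ioi (0 : ℝ),
      r ^ (Module.finrank ℝ E - 1) * ∫ u, g (r • (u : E)) ∂ν.toSphere := by
  have hmp := ν.measurePreserving_homeomorphUnitSphereProd
  have hemb := Homeomorph.measurableEmbedding (homeomorphUnitSphereProd E)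
  set G : Metric.sphere (0 : E) 1 × Set.Ioi (0 : ℝ) → ℝ := fun p => g ((p.2 : ℝ) • (p.1 : E))
  have hG : ∀ x : ({(0)}ᶜ : Set E), G (homeomorphUnitSphereProd E x) = g x := fun x => by
    simp only [G]
    rw [← homeomorphUnitSphereProd_symm_apply_coe, Homeomorph.symm_apply_apply]
  have hint : Integrable G (ν.toSphere.prod (.volumeIoiPow (Module.finrank ℝ E - 1))) := by
    rw [← hmp.integrable_comp_emb hemb]
    have : G ∘ homeomorphUnitSphereProd E = fun x : ({(0)}ᶜ : Set E) => g x := funext hG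
    rw [this]
    exact (integrableOn_iff_comap_subtypeVal (measurableSet_singleton (0 : E)).compl).1
      hg.integrableOn
  calc
    ∫ x, g x ∂ν = ∫ x : ({(0)}ᶜ : Set E), g x ∂(ν.comap (↑)) := by
      rw [integral_subtype_comap (measurableSet_singleton _).compl fun x => g x,
        restrict_compl_singleton]
    _ = ∫ p, G p ∂ν.toSphere.prod (.volumeIoiPow (Module.finrank ℝ E - 1)) := by
      rw [← hmp.integral_comp hemb G]
      exact integral_congr_ae (.of_forall fun x => (hG x).symm)
    _ = ∫ r : Set.Ioi (0 : ℝ), (∫ u, g ((r : ℝ) • (u : E)) ∂ν.toSphere)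
          ∂.volumeIoiPow (Module.finrank ℝ E - 1) := integral_prod_symm _ hint
    _ = _ := by
      simp only [Measure.volumeIoiPow, ENNReal.ofReal]
      rw [integral_withDensity_eq_integral_smul,
        integral_subtype_comap measurableSet_Ioi
          fun a => Real.toNNReal (a ^ (Module.finrank ℝ E - 1)) •
            ∫ u, g (a • (u : E)) ∂ν.toSphere]
      · refine setIntegral_congr_fun measurableSet_Ioi fun x hx => ?_
        simp only [NNReal.smul_def]
        rw [Real.coe_toNNReal _ (pow_nonneg hx.out.le _), smul_eq_mul]
      · exact (measurable_subtype_coe.pow_const _).real_toNNReal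

/-- The integral of a function over the sphere of radius `r`. -/
def sphereMean [NormedSpace ℝ E] (ν : Measure E) (g : E → ℝ) (r : ℝ) : ℝ :=
  r ^ (Module.finrank ℝ E - 1) * ∫ u, g (r • (u : E)) ∂ν.toSphere

theorem continuous_sphereMean [NormedSpace ℝ E] [FiniteDimensional ℝ E]
    (ν : Measure E) [ν.IsAddHaarMeasure] {g : E → ℝ} (hg : Continuous g) :
    Continuous (sphereMean ν g) := by
  refine (continuous_pow _).mul ?_
  have h := continuous_parametric_integral_of_continuous (μ := ν.toSphere)
    (f := fun (r : ℝ) (u : Metric.sphere (0 : E) 1) => g (r • (u : E))) (by fun_prop)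
    (s := Set.univ) isCompact_univ
  simpa using h

/-- Polar coordinates for a radial weight `h` supported in the ball of radius `R`. -/
theorem integral_radial_mul [NormedSpace ℝ E] [FiniteDimensional ℝ E] [Nontrivial E]
    (ν : Measure E) [ν.IsAddHaarMeasure] {g : E → ℝ} {h : ℝ → ℝ} {R : ℝ} (hR : 0 < R)
    (hint : Integrable (fun x => h ‖x‖ * g x) ν) (h0 : ∀ r, R < r → h r = 0) :
    ∫ x, h ‖x‖ * g x ∂ν = ∫ r in (0 : ℝ)..R, h r * sphereMean ν g r := by
  rw [integral_eq_integral_Ioi_toSphere ν hint, intervalIntegral.integral_of_le hR.le]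
  rw [← Set.Ioc_union_Ioi_eq_Ioi hR.le]
  have key : ∀ r ∈ Set.Ioi (0 : ℝ), r ^ (Module.finrank ℝ E - 1) *
      ∫ u : Metric.sphere (0 : E) 1, h ‖r • (u : E)‖ * g (r • (u : E)) ∂ν.toSphere
      = h r * sphereMean ν g r := fun r hr => by
    have : ∀ u : Metric.sphere (0 : E) 1, ‖r • (u : E)‖ = r := fun u => by
      simp [norm_smul, abs_of_pos hr.out]
    simp only [this, integral_const_mul, sphereMean]
    ring
  have hz : ∀ r ∈ Set.Ioi R, r ^ (Module.finrank ℝ E - 1) *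
      ∫ u : Metric.sphere (0 : E) 1, h ‖r • (u : E)‖ * g (r • (u : E)) ∂ν.toSphere = 0 :=
    fun r hr => by rw [key r (hR.trans hr), h0 r hr, zero_mul]
  rw [setIntegral_eq_of_subset_of_forall_sdiff_eq_zero
    (measurableSet_Ioc.union measurableSet_Ioi) Set.subset_union_left]
  · exact setIntegral_congr_fun measurableSet_Ioc fun r hr => key r hr.1
  · rintro r ⟨hr | hr, hn⟩
    · exact absurd hr hn
    · exact hz r hr

theorem hasDerivAt_integral_of_continuous {p : ℝ → ℝ} (hp : Continuous p) (R : ℝ) :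
    HasDerivAt (fun R => ∫ r in (0 : ℝ)..R, p r) (p R) R :=
  intervalIntegral.integral_hasDerivAt_right (hp.intervalIntegrable _ _)
    hp.aestronglyMeasurable.stronglyMeasurableAtFilter hp.continuousAt

/-- Differentiating twice in `R` strips the weights. The first derivative, divided by `4R`, is `R² ∫
p - ∫ r² p = 2 ∫ q`; the second is `2R ∫ p = 2 q(R)`. After expansion into moments no integrand
depends on `R`, so the fundamental theorem of calculus suffices. -/
theorem integral_eq_of_forall_integral_sq_mul {p q : ℝ → ℝ} (hp : Continuous p)
    (hq : Continuous q)
    (h : ∀ R, 0 < R → ∫ r in (0 : ℝ)..R, (R ^ 2 - r ^ 2) ^ 2 * p r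
      = ∫ r in (0 : ℝ)..R, 4 * (R ^ 2 - r ^ 2) * q r) {R : ℝ} (hR : 0 < R) :
    R * ∫ r in (0 : ℝ)..R, p r = q R := by
  have ii : ∀ {f : ℝ → ℝ}, Continuous f → ∀ R, IntervalIntegrable f volume 0 R :=
    fun hf R => hf.intervalIntegrable _ _
  set P0 := fun R : ℝ => ∫ r in (0 : ℝ)..R, p r
  set P2 := fun R : ℝ => ∫ r in (0 : ℝ)..R, r ^ 2 * p r
  set P4 := fun R : ℝ => ∫ r in (0 : ℝ)..R, r ^ 4 * p r
  set Q0 := fun R : ℝ => ∫ r in (0 : ℝ)..R, q r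
  set Q2 := fun R : ℝ => ∫ r in (0 : ℝ)..R, r ^ 2 * q r
  have dP0 := fun R => hasDerivAt_integral_of_continuous hp R
  have dP2 := fun R => hasDerivAt_integral_of_continuous (p := fun r => r ^ 2 * p r)
    (by fun_prop) R
  have dP4 := fun R => hasDerivAt_integral_of_continuous (p := fun r => r ^ 4 * p r)
    (by fun_prop) R
  have dQ0 := fun R => hasDerivAt_integral_of_continuous hq R
  have dQ2 := fun R => hasDerivAt_integral_of_continuous (p := fun r => r ^ 2 * q r)
    (by fun_prop) R
  have e1 : ∀ R, ∫ r in (0 : ℝ)..R, (R ^ 2 - r ^ 2) ^ 2 * p r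
      = R ^ 4 * P0 R - 2 * R ^ 2 * P2 R + P4 R := fun R => by
    simp only [P0, P2, P4]
    rw [← intervalIntegral.integral_const_mul, ← intervalIntegral.integral_const_mul,
      ← intervalIntegral.integral_sub (ii (by fun_prop) R) (ii (by fun_prop) R),
      ← intervalIntegral.integral_add (ii (by fun_prop) R) (ii (by fun_prop) R)]
    congr 1; ext r; ring
  have e2 : ∀ R, ∫ r in (0 : ℝ)..R, 4 * (R ^ 2 - r ^ 2) * q r
      = 4 * R ^ 2 * Q0 R - 4 * Q2 R := fun R => by
    simp only [Q0, Q2]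
    rw [← intervalIntegral.integral_const_mul, ← intervalIntegral.integral_const_mul,
      ← intervalIntegral.integral_sub (ii (by fun_prop) R) (ii (by fun_prop) R)]
    congr 1; ext r; ring
  have hpos : ∀ R : ℝ, 0 < R → ∀ᶠ S in nhds R, 0 < S := fun R hR => lt_mem_nhds hR
  have s1 : ∀ R, 0 < R → R ^ 2 * P0 R - P2 R = 2 * Q0 R := fun R hR => by
    have d1 := ((((hasDerivAt_pow 4 R).mul (dP0 R)).sub
      (((hasDerivAt_pow 2 R).const_mul 2).mul (dP2 R))).add (dP4 R))
    have d2 := (((hasDerivAt_pow 2 R).const_mul 4).mul (dQ0 R)).sub ((dQ2 R).const_mul 4)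
    have := d1.unique (d2.congr_of_eventuallyEq ((hpos R hR).mono fun S hS => by
      simpa [e1, e2] using h S hS))
    simp only [Nat.cast_ofNat, show 4 - 1 = 3 from rfl, show 2 - 1 = 1 from rfl] at this
    have h4 : 4 * R * (R ^ 2 * P0 R - P2 R) = 4 * R * (2 * Q0 R) := by
      simp only [P0, P2, Q0]
      linarith [this]
    exact mul_left_cancel₀ (by positivity) h4
  have d1 := ((hasDerivAt_pow 2 R).mul (dP0 R)).sub (dP2 R)
  have d2 := (dQ0 R).const_mul 2
  have := d1.unique (d2.congr_of_eventuallyEq ((hpos R hR).mono fun S hS => by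
    simpa using s1 S hS))
  simp only [Nat.cast_ofNat, show 2 - 1 = 1 from rfl] at this
  linarith [this]

/-- The square smooths the kink of the positive part, so that a truncated weight is admissible in an
integration by parts over the whole space. -/
theorem hasDerivAt_sq_max_zero (t : ℝ) : HasDerivAt (fun t : ℝ => max t 0 ^ 2) (2 * max t 0) t := by
  rcases lt_trichotomy t 0 with h | rfl | h
  · have : (fun t : ℝ => max t 0 ^ 2) =ᶠ[nhds t] fun _ => 0 :=
      (gt_mem_nhds h).mono fun s hs => by simp [max_eq_right (le_of_lt hs)]
    simpa [max_eq_right h.le] using (hasDerivAt_const t (0 : ℝ)).congr_of_eventuallyEq this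
  · rw [hasDerivAt_iff_isLittleO_nhds_zero]
    simp only [zero_add, max_self, mul_zero, smul_zero, sub_zero, ne_eq, OfNat.ofNat_ne_zero,
      not_false_eq_true, zero_pow]
    refine Asymptotics.IsBigO.trans_isLittleO (g := fun h : ℝ => h ^ 2) ?_ ?_
    · refine Asymptotics.IsBigO.of_bound 1 (.of_forall fun x => ?_)
      rcases le_total x 0 with hx | hx <;> simp [hx, sq_nonneg]
    · simpa using Asymptotics.isLittleO_pow_id (𝕜 := ℝ) (n := 2) (by norm_num)
  · have : (fun t : ℝ => max t 0 ^ 2) =ᶠ[nhds t] fun s => s ^ 2 :=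
      (lt_mem_nhds h).mono fun s hs => by simp [max_eq_left (le_of_lt hs)]
    simpa [max_eq_left h.le] using (hasDerivAt_pow 2 t).congr_of_eventuallyEq this

variable [InnerProductSpace ℝ E] [FiniteDimensional ℝ E]

theorem hasFDerivAt_sq_max_norm {E : Type*} [NormedAddCommGroup E] [InnerProductSpace ℝ E]
    (R : ℝ) (x : E) :
    HasFDerivAt (fun x : E => max (R ^ 2 - ‖x‖ ^ 2) 0 ^ 2)
      ((-4 * max (R ^ 2 - ‖x‖ ^ 2) 0) • innerSL ℝ x) x := by
  have h1 : HasFDerivAt (fun x : E => R ^ 2 - ‖x‖ ^ 2) (-((2 : ℝ) • innerSL ℝ x)) x := by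
    have := (hasStrictFDerivAt_norm_sq x).hasFDerivAt.const_sub (R ^ 2)
    refine this.congr_fderiv ?_
    ext v
    simp
  have h2 := (hasDerivAt_sq_max_zero (R ^ 2 - ‖x‖ ^ 2)).comp_hasFDerivAt x h1
  refine h2.congr_fderiv ?_
  ext v
  simp
  ring

/-- The weight is differentiable and vanishes outside the ball of radius `|R|`, so integration by
parts over the whole space leaves no boundary term. The sphere is recovered later by differentiating
in `R`. -/
theorem integral_sq_max_mul_fderiv (ν : Measure E) [ν.IsAddHaarMeasure] {φ : E → ℝ}
    (hφ : Differentiable ℝ φ) {e : E} (hφ' : Continuous fun x => fderiv ℝ φ x e) (R : ℝ) :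
    ∫ x, max (R ^ 2 - ‖x‖ ^ 2) 0 ^ 2 * fderiv ℝ φ x e ∂ν
      = ∫ x, 4 * max (R ^ 2 - ‖x‖ ^ 2) 0 * (inner ℝ x e * φ x) ∂ν := by
  have hc := hφ.continuous
  have hsupp : ∀ {g : E → ℝ}, Continuous g → (∀ x, |R| < ‖x‖ → g x = 0) → Integrable g ν := by
    intro g hg h0
    refine hg.integrable_of_hasCompactSupport
      (HasCompactSupport.intro (isCompact_closedBall (0 : E) |R|) fun x hx => h0 x ?_)
    simpa using hx
  have hm : ∀ x : E, |R| < ‖x‖ → max (R ^ 2 - ‖x‖ ^ 2) 0 = 0 := fun x hx => by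
    refine max_eq_right ?_
    have := sq_lt_sq' (by linarith [abs_nonneg R, norm_nonneg x]) hx
    rw [sq_abs] at this
    linarith
  have h := integral_bilinear_hasFDerivAt_right_eq_neg_left_of_integrable (μ := ν)
    (B := ContinuousLinearMap.mul ℝ ℝ) (f := φ) (f' := fun x => fderiv ℝ φ x)
    (g := fun x : E => max (R ^ 2 - ‖x‖ ^ 2) 0 ^ 2)
    (g' := fun x => (-4 * max (R ^ 2 - ‖x‖ ^ 2) 0) • innerSL ℝ x) (v := e)
    (hsupp (by simp only [ContinuousLinearMap.mul_apply']; fun_prop)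
      (fun x hx => by simp [hm x hx]))
    (hsupp (by
      simp only [ContinuousLinearMap.mul_apply', smul_apply,
        innerSL_apply_apply]
      fun_prop) (fun x hx => by simp [hm x hx]))
    (hsupp (by simp only [ContinuousLinearMap.mul_apply']; fun_prop)
      (fun x hx => by simp [hm x hx]))
    (fun x _ => (hφ x).hasFDerivAt) (fun x _ => hasFDerivAt_sq_max_norm R x)
  simp only [ContinuousLinearMap.mul_apply', smul_apply,
    innerSL_apply_apply, smul_eq_mul] at h
  rw [← neg_eq_iff_eq_neg, ← integral_neg] at h
  rw [integral_congr_ae (.of_forall fun x => mul_comm _ _), ← h]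
  exact integral_congr_ae (.of_forall fun x => by ring_nf)

/-- The divergence theorem on the unit ball, for the vector field `φ e`. -/
theorem integral_ball_fderiv_eq_integral_toSphere [Nontrivial E] (ν : Measure E)
    [ν.IsAddHaarMeasure] {φ : E → ℝ} (hφ : Differentiable ℝ φ) {e : E}
    (hφ' : Continuous fun x => fderiv ℝ φ x e) :
    ∫ x in Metric.closedBall 0 1, fderiv ℝ φ x e ∂ν
      = ∫ u, φ u * inner ℝ (u : E) e ∂ν.toSphere := by
  have hc := hφ.continuous
  have hsupp : ∀ {R : ℝ} {g : E → ℝ}, Continuous g → (∀ x, |R| < ‖x‖ → g x = 0) →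
      Integrable g ν := by
    intro R g hg h0
    refine hg.integrable_of_hasCompactSupport
      (HasCompactSupport.intro (isCompact_closedBall (0 : E) |R|) fun x hx => h0 x ?_)
    simpa using hx
  have hm : ∀ {R r : ℝ}, 0 < R → R < r → max (R ^ 2 - r ^ 2) 0 = 0 := fun {R r} hR hx =>
    max_eq_right (by nlinarith)
  set p := sphereMean ν fun x => fderiv ℝ φ x e
  set q := sphereMean ν fun x => inner ℝ x e * φ x
  have hp : Continuous p := continuous_sphereMean ν hφ'
  have hq : Continuous q := continuous_sphereMean ν (by fun_prop)
  -- Polar coordinates turn the weighted identities into radial ones for the sphere integrals `p` of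
  -- the derivative and `q` of the flux. At `R = 1` the conclusion `∫ p = q(1)` is the theorem.
  have key := integral_eq_of_forall_integral_sq_mul hp hq (fun R hR => by
    have h1 := integral_radial_mul ν (g := fun x => fderiv ℝ φ x e)
      (h := fun r => max (R ^ 2 - r ^ 2) 0 ^ 2) hR
      (hsupp (R := R) (by fun_prop) fun x hx => by
        rw [hm hR (by rwa [abs_of_pos hR] at hx)]; simp)
      (fun r hr => by simp only [hm hR hr]; simp)
    have h2 := integral_radial_mul ν (g := fun x => inner ℝ x e * φ x)
      (h := fun r => 4 * max (R ^ 2 - r ^ 2) 0) hR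
      (hsupp (R := R) (by fun_prop) fun x hx => by
        rw [hm hR (by rwa [abs_of_pos hR] at hx)]; simp)
      (fun r hr => by simp only [hm hR hr]; simp)
    have hr : ∀ r ∈ Set.uIcc 0 R, max (R ^ 2 - r ^ 2) 0 = R ^ 2 - r ^ 2 := fun r hr => by
      rw [Set.uIcc_of_le hR.le] at hr
      exact max_eq_left (by nlinarith [hr.1, hr.2])
    rw [integral_sq_max_mul_fderiv ν hφ hφ' R, h2] at h1
    calc
      _ = ∫ r in (0 : ℝ)..R, max (R ^ 2 - r ^ 2) 0 ^ 2 * p r :=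
        intervalIntegral.integral_congr fun r h => by simp only [hr r h]
      _ = ∫ r in (0 : ℝ)..R, 4 * max (R ^ 2 - r ^ 2) 0 * q r := h1.symm
      _ = _ := intervalIntegral.integral_congr fun r h => by simp only [hr r h]) one_pos
  have hb : ∫ x in Metric.closedBall 0 1, fderiv ℝ φ x e ∂ν = ∫ r in (0 : ℝ)..1, p r := by
    have h1 := integral_radial_mul ν (g := fun x => fderiv ℝ φ x e)
      (h := fun r => if r ≤ 1 then 1 else 0) one_pos
      (by
        have : Integrable ((Metric.closedBall (0 : E) 1).indicator fun x => fderiv ℝ φ x e) ν :=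
          (integrable_indicator_iff measurableSet_closedBall).2
            (hφ'.continuousOn.integrableOn_compact (isCompact_closedBall _ _))
        refine this.congr (.of_forall fun x => ?_)
        simp [Set.indicator])
      (fun r hr => if_neg (not_le.2 hr))
    rw [← integral_indicator measurableSet_closedBall]
    refine Eq.trans (integral_congr_ae (.of_forall fun x => ?_)) (h1.trans ?_)
    · simp [Set.indicator]
    · refine intervalIntegral.integral_congr fun r hr => ?_
      rw [Set.uIcc_of_le zero_le_one] at hr
      simp [hr.2, p]
  rw [hb, ← one_mul (∫ r in (0 : ℝ)..1, p r), key]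
  simp only [q, sphereMean, one_pow, one_smul, one_mul]
  exact integral_congr_ae (.of_forall fun x => mul_comm _ _)

end Divergence

/-! ### Smooth functions and their averages -/

section Smooth

variable {E : Type*} [NormedAddCommGroup E] [InnerProductSpace ℝ E] [CompleteSpace E]

/-- `g` is differentiable and its gradient is `L`-Lipschitz. -/
structure IsSmooth (L : ℝ) (g : E → ℝ) : Prop where
  differentiable : Differentiable ℝ g
  norm_gradient_sub_le : ∀ x y, ‖gradient g x - gradient g y‖ ≤ L * ‖x - y‖

namespace IsSmooth

variable {L : ℝ} {g : E → ℝ}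

/-- Along the segment the remainder has derivative at most `L t ‖h‖²` in absolute value; it is
compared with `L/2 ‖h‖² t²` at `t = 1`. -/
theorem abs_sub_sub_inner_le (hg : IsSmooth L g) (x h : E) :
    |g (x + h) - g x - inner ℝ (gradient g x) h| ≤ L / 2 * ‖h‖ ^ 2 := by
  have hd : ∀ t : ℝ, HasDerivAt (fun t : ℝ => g (x + t • h) - g x - t * inner ℝ (gradient g x) h)
      (inner ℝ (gradient g (x + t • h) - gradient g x) h) t := fun t => by
    have h1 : HasDerivAt (fun t : ℝ => x + t • h) h t := by
      simpa using ((hasDerivAt_id t).smul_const h).const_add x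
    have h2 := (hg.differentiable (x + t • h)).hasGradientAt.hasFDerivAt.comp_hasDerivAt t h1
    have h3 := (h2.sub_const (g x)).sub ((hasDerivAt_id t).mul_const (inner ℝ (gradient g x) h))
    refine h3.congr_deriv ?_
    simp [inner_sub_left]
  have hB : ∀ t : ℝ, HasDerivAt (fun t : ℝ => L / 2 * ‖h‖ ^ 2 * t ^ 2) (L * t * ‖h‖ ^ 2) t :=
    fun t => ((hasDerivAt_pow 2 t).const_mul _).congr_deriv (by
      simp only [Nat.cast_ofNat, show 2 - 1 = 1 from rfl]; ring)
  have key := image_norm_le_of_norm_deriv_right_le_deriv_boundary (a := 0) (b := 1)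
    (f := fun t : ℝ => g (x + t • h) - g x - t * inner ℝ (gradient g x) h)
    (f' := fun t => inner ℝ (gradient g (x + t • h) - gradient g x) h)
    (B := fun t : ℝ => L / 2 * ‖h‖ ^ 2 * t ^ 2) (B' := fun t => L * t * ‖h‖ ^ 2)
    (fun t _ => (hd t).continuousAt.continuousWithinAt)
    (fun t _ => (hd t).hasDerivWithinAt) (by simp) (fun t => hB t)
    (fun t ht => by
      refine (norm_inner_le_norm _ _).trans ?_
      have := hg.norm_gradient_sub_le (x + t • h) x
      rw [add_sub_cancel_left, norm_smul, Real.norm_of_nonneg ht.1] at this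
      nlinarith [norm_nonneg h])
    (x := 1) (by simp)
  simpa using key

theorem continuous_gradient (hg : IsSmooth L g) : Continuous (gradient g) := by
  refine (LipschitzWith.of_dist_le_mul (K := L.toNNReal) fun x y => ?_).continuous
  rw [dist_eq_norm, dist_eq_norm]
  exact (hg.norm_gradient_sub_le x y).trans
    (mul_le_mul_of_nonneg_right (Real.le_coe_toNNReal L) (norm_nonneg _))

theorem of_hasGradientAt {g' : E → E} (h : ∀ x, HasGradientAt g (g' x) x)
    (hL : ∀ x y, ‖g' x - g' y‖ ≤ L * ‖x - y‖) : IsSmooth L g where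
  differentiable x := (h x).differentiableAt
  norm_gradient_sub_le x y := by rw [(h x).gradient, (h y).gradient]; exact hL x y

theorem hasGradientAt_comp_add_smul (hg : IsSmooth L g) (μ : ℝ) (c x : E) :
    HasGradientAt (fun y => g (c + μ • y)) (μ • gradient g (c + μ • x)) x := by
  have h1 : HasFDerivAt (fun y : E => c + μ • y) (μ • ContinuousLinearMap.id ℝ E) x :=
    ((hasFDerivAt_id x).const_smul μ).const_add c
  have h2 := (hg.differentiable (c + μ • x)).hasGradientAt.hasFDerivAt.comp x h1
  rw [hasGradientAt_iff_hasFDerivAt]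
  refine h2.congr_fderiv ?_
  ext v
  simp

theorem hasGradientAt_comp_add_right (hg : IsSmooth L g) (c x : E) :
    HasGradientAt (fun y => g (y + c)) (gradient g (x + c)) x := by
  have := hg.hasGradientAt_comp_add_smul 1 c x
  simpa [add_comm] using this

theorem comp_add_right (hg : IsSmooth L g) (c : E) : IsSmooth L fun y => g (y + c) :=
  of_hasGradientAt (hg.hasGradientAt_comp_add_right c) fun x y => by
    simpa using hg.norm_gradient_sub_le (x + c) (y + c)

section Average

variable {Z : Type*} [MeasurableSpace Z] {ν : Measure Z} {G : E → Z → ℝ}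

/-- Only the values of `G` are known to be measurable in `z`, so the directional derivative is
obtained as a limit of difference quotients. Smoothness over the single step `e` supplies the
integrable majorant. -/
theorem integrable_inner_gradient [IsFiniteMeasure ν] (hG : ∀ z, IsSmooth L fun x => G x z)
    (hint : ∀ x, Integrable (G x) ν) (x e : E) :
    Integrable (fun z => inner ℝ (gradient (fun y => G y z) x) e) ν := by
  refine Integrable.mono' (g := fun z => |G (x + e) z - G x z| + L / 2 * ‖e‖ ^ 2)
    (((hint _).sub (hint _)).abs.add (integrable_const _)) ?_ (.of_forall fun z => ?_)
  · refine aestronglyMeasurable_of_tendsto_ae Filter.atTop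
      (f := fun (n : ℕ) z => ((n : ℝ) + 1) * (G (x + ((n : ℝ) + 1)⁻¹ • e) z - G x z))
      (fun n => (((hint _).sub (hint _)).const_mul _).aestronglyMeasurable)
      (.of_forall fun z => ?_)
    have h0 : Filter.Tendsto (fun n : ℕ => L / 2 * ‖e‖ ^ 2 * (1 / ((n : ℝ) + 1)))
        Filter.atTop (nhds 0) := by
      have h := (tendsto_one_div_add_atTop_nhds_zero_nat (𝕜 := ℝ)).const_mul (L / 2 * ‖e‖ ^ 2)
      rwa [mul_zero] at h
    rw [tendsto_iff_norm_sub_tendsto_zero]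
    refine squeeze_zero (fun n => norm_nonneg _) (fun n => ?_) h0
    have hn : (0 : ℝ) < (n : ℝ) + 1 := by positivity
    have h := (hG z).abs_sub_sub_inner_le x (((n : ℝ) + 1)⁻¹ • e)
    rw [norm_smul, inner_smul_right, Real.norm_of_nonneg (by positivity)] at h
    rw [Real.norm_eq_abs]
    have e1 : ((n : ℝ) + 1) * (G (x + ((n : ℝ) + 1)⁻¹ • e) z - G x z)
        - inner ℝ (gradient (fun y => G y z) x) e
        = ((n : ℝ) + 1) * (G (x + ((n : ℝ) + 1)⁻¹ • e) z - G x z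
          - ((n : ℝ) + 1)⁻¹ * inner ℝ (gradient (fun y => G y z) x) e) := by
      field_simp
    rw [e1, abs_mul, abs_of_pos hn]
    refine (mul_le_mul_of_nonneg_left h hn.le).trans (le_of_eq ?_)
    field_simp
  · have h := (hG z).abs_sub_sub_inner_le x e
    rw [Real.norm_eq_abs]
    have := abs_sub_abs_le_abs_sub (inner ℝ (gradient (fun y => G y z) x) e) (G (x + e) z - G x z)
    rw [abs_sub_comm (inner ℝ _ _)] at this
    linarith

variable [FiniteDimensional ℝ E]

theorem integrable_gradient [IsFiniteMeasure ν] (hG : ∀ z, IsSmooth L fun x => G x z)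
    (hint : ∀ x, Integrable (G x) ν) (x : E) :
    Integrable (fun z => gradient (fun y => G y z) x) ν := by
  have h : ∀ z, gradient (fun y => G y z) x = ∑ i, inner ℝ (gradient (fun y => G y z) x)
      (stdOrthonormalBasis ℝ E i) • stdOrthonormalBasis ℝ E i := fun z => by
    conv_lhs => rw [← (stdOrthonormalBasis ℝ E).sum_repr' (gradient (fun y => G y z) x)]
    simp only [real_inner_comm]
  rw [integrable_congr (.of_forall h)]
  exact integrable_finsetSum _ fun i _ =>
    (integrable_inner_gradient hG hint x _).smul_const _

/-- The quadratic remainder bound has the same constant for every `z`, so it can be integrated as it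
stands; no dominated convergence is needed. -/
theorem hasGradientAt_integral [IsProbabilityMeasure ν] (hG : ∀ z, IsSmooth L fun x => G x z)
    (hint : ∀ x, Integrable (G x) ν) (x : E) :
    HasGradientAt (fun x => ∫ z, G x z ∂ν) (∫ z, gradient (fun y => G y z) x ∂ν) x := by
  rw [hasGradientAt_iff_hasFDerivAt, hasFDerivAt_iff_isLittleO_nhds_zero]
  refine Asymptotics.IsBigO.trans_isLittleO (g := fun h : E => ‖h‖ ^ 2) ?_ ?_
  · refine Asymptotics.IsBigO.of_bound (L / 2) (.of_forall fun h => ?_)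
    have hi := integrable_gradient hG hint x
    have e1 : (∫ z, G (x + h) z ∂ν) - (∫ z, G x z ∂ν)
        - InnerProductSpace.toDual ℝ E (∫ z, gradient (fun y => G y z) x ∂ν) h
        = ∫ z, (G (x + h) z - G x z - inner ℝ (gradient (fun y => G y z) x) h) ∂ν := by
      have hd : Integrable (fun z => G (x + h) z - G x z) ν := (hint _).sub (hint _)
      rw [integral_sub hd (hi.inner_const h),
        integral_sub (hint _) (hint _), InnerProductSpace.toDual_apply_apply]
      congr 1
      rw [real_inner_comm, ← integral_inner hi h]
      simp only [real_inner_comm]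
    rw [e1]
    refine (norm_integral_le_of_norm_le_const (C := L / 2 * ‖h‖ ^ 2)
      (.of_forall fun z => (hG z).abs_sub_sub_inner_le x h)).trans ?_
    simp
  · exact (Asymptotics.isLittleO_norm_pow_id (by norm_num))

theorem integral [IsProbabilityMeasure ν] (hG : ∀ z, IsSmooth L fun x => G x z)
    (hint : ∀ x, Integrable (G x) ν) : IsSmooth L fun x => ∫ z, G x z ∂ν :=
  of_hasGradientAt (hasGradientAt_integral hG hint) fun x y => by
    rw [← integral_sub (integrable_gradient hG hint x) (integrable_gradient hG hint y)]
    refine (norm_integral_le_of_norm_le_const (C := L * ‖x - y‖)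
      (.of_forall fun z => (hG z).norm_gradient_sub_le x y)).trans ?_
    simp

end Average

end IsSmooth

end Smooth

/-! ### Uniform distributions on the sphere and the ball -/

section Uniform

variable {d : ℕ}

theorem volume_ball_ne_zero : (volume : Measure (Vec d)) (Metric.closedBall 0 1) ≠ 0 :=
  (Metric.measure_closedBall_pos _ _ one_pos).ne'

theorem volume_ball_ne_top : (volume : Measure (Vec d)) (Metric.closedBall 0 1) ≠ ⊤ :=
  measure_closedBall_lt_top.ne

theorem toSphere_real_univ :
    (Measure.toSphere (volume : Measure (Vec d))).real Set.univ
      = d * (volume : Measure (Vec d)).real (Metric.closedBall 0 1) := by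
  rw [Measure.toSphere_real_apply_univ, finrank_euclideanSpace_fin, measureReal_def,
    measureReal_def, Measure.addHaar_unitClosedBall_eq_addHaar_unitBall]

instance : IsProbabilityMeasure (ballUniform d) :=
  cond_isProbabilityMeasure_of_finite volume_ball_ne_zero volume_ball_ne_top

instance [NeZero d] : IsProbabilityMeasure (sphereUniform d) := by
  have : Nontrivial (Vec d) := inferInstance
  have : IsProbabilityMeasure
      (ProbabilityTheory.cond (Measure.toSphere (volume : Measure (Vec d))) Set.univ) :=
    cond_isProbabilityMeasure (by
      simp [NeZero.ne d, (Metric.measure_ball_pos (volume : Measure (Vec d)) 0 one_pos).ne'])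
  exact Measure.isProbabilityMeasure_map measurable_subtype_coe.aemeasurable

theorem ae_norm_sphereUniform : ∀ᵐ u ∂(sphereUniform d), ‖u‖ = 1 := by
  rw [sphereUniform, ae_map_iff measurable_subtype_coe.aemeasurable
    (measurableSet_eq_fun measurable_norm measurable_const)]
  exact .of_forall fun u => by simp

theorem ae_norm_ballUniform : ∀ᵐ u ∂(ballUniform d), ‖u‖ ≤ 1 := by
  filter_upwards [ae_cond_mem (μ := (volume : Measure (Vec d)))
    (measurableSet_closedBall (x := 0) (ε := 1))] with u hu
  simpa using hu

theorem integral_ballUniform (g : Vec d → ℝ) :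
    ∫ u, g u ∂(ballUniform d)
      = ((volume : Measure (Vec d)).real (Metric.closedBall 0 1))⁻¹
        * ∫ u in Metric.closedBall 0 1, g u := by
  rw [ballUniform, ProbabilityTheory.cond, integral_smul_measure, ENNReal.toReal_inv,
    smul_eq_mul, measureReal_def]

theorem integral_sphereUniform (g : Vec d → ℝ) (hg : Continuous g) :
    ∫ u, g u ∂(sphereUniform d)
      = (d * (volume : Measure (Vec d)).real (Metric.closedBall 0 1))⁻¹
        * ∫ u, g (u : Vec d) ∂(Measure.toSphere (volume : Measure (Vec d))) := by
  rw [sphereUniform, integral_map measurable_subtype_coe.aemeasurable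
    hg.aestronglyMeasurable, ProbabilityTheory.cond, integral_smul_measure, ENNReal.toReal_inv,
    smul_eq_mul, Measure.restrict_univ, ← toSphere_real_univ, measureReal_def]

theorem integrable_ballUniform {H : Type*} [NormedAddCommGroup H] {g : Vec d → H}
    (hg : Continuous g) : Integrable g (ballUniform d) := by
  rw [ballUniform, ProbabilityTheory.cond]
  refine Integrable.smul_measure ?_ (ENNReal.inv_ne_top.2 volume_ball_ne_zero)
  exact hg.continuousOn.integrableOn_compact (isCompact_closedBall _ _)

variable [NeZero d]

/-- The divergence theorem for the field `φ e`, normalised: the sphere has `d` times the mass of the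
ball, hence the factor `d`. -/
theorem integral_sphereUniform_mul_inner {φ : Vec d → ℝ} {φ' : Vec d → Vec d}
    (hφ : ∀ x, HasGradientAt φ (φ' x) x) (hφ' : Continuous φ') (e : Vec d) :
    d * ∫ u, φ u * inner ℝ u e ∂(sphereUniform d) = ∫ u, inner ℝ (φ' u) e ∂(ballUniform d) := by
  have hfd : ∀ x, fderiv ℝ φ x e = inner ℝ (φ' x) e := fun x => by
    rw [(hφ x).hasFDerivAt.fderiv]; simp
  have hd : Differentiable ℝ φ := fun x => (hφ x).differentiableAt
  have hc := hd.continuous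
  have key := integral_ball_fderiv_eq_integral_toSphere (volume : Measure (Vec d)) hd (e := e)
    (by simp only [hfd]; fun_prop)
  simp only [hfd] at key
  rw [integral_ballUniform, integral_sphereUniform _ (by fun_prop), key]
  have : (d : ℝ) ≠ 0 := Nat.cast_ne_zero.2 (NeZero.ne d)
  field_simp

/-- The case of the linear function `⟨a, ·⟩`, whose gradient is constant. The factor `1/d` is what
saves one power of the dimension in the variance. -/
theorem integral_sphereUniform_inner_sq (a : Vec d) :
    ∫ u, inner ℝ a u ^ 2 ∂(sphereUniform d) = ‖a‖ ^ 2 / d := by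
  have h := integral_sphereUniform_mul_inner (d := d) (φ := fun u => inner ℝ a u)
    (φ' := fun _ => a) (fun x => by
      rw [hasGradientAt_iff_hasFDerivAt]
      exact (innerSL ℝ a).hasFDerivAt) continuous_const a
  have : (d : ℝ) ≠ 0 := Nat.cast_ne_zero.2 (NeZero.ne d)
  simp only [integral_const, probReal_univ, one_smul, real_inner_self_eq_norm_sq] at h
  rw [← h]
  field_simp
  exact integral_congr_ae (.of_forall fun u => by
    simp only [real_inner_comm a u]; ring)

/-- The functions `‖u‖²` and `1` agree on the sphere, so their gradients `2u` and `0` have the same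
average over the ball. -/
theorem integral_ballUniform_inner (a : Vec d) : ∫ u, inner ℝ u a ∂(ballUniform d) = 0 := by
  have h1 := integral_sphereUniform_mul_inner (d := d) (φ := fun u => ‖u‖ ^ 2)
    (φ' := fun u => (2 : ℝ) • u)
    (fun x => by
      rw [hasGradientAt_iff_hasFDerivAt]
      refine (hasStrictFDerivAt_norm_sq x).hasFDerivAt.congr_fderiv ?_
      ext v; simp) (by fun_prop) a
  have h2 := integral_sphereUniform_mul_inner (d := d) (φ := fun _ => 1) (φ' := fun _ => 0)
    (fun x => hasGradientAt_const _ _) (by fun_prop) a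
  have h3 : ∫ u, ‖u‖ ^ 2 * inner ℝ u a ∂(sphereUniform d)
      = ∫ u, 1 * inner ℝ u a ∂(sphereUniform d) :=
    integral_congr_ae (ae_norm_sphereUniform.mono fun u hu => by simp [hu])
  rw [h3, h2] at h1
  simp only [inner_zero_left, integral_zero, inner_smul_left, integral_const_mul] at h1
  simpa using h1.symm

theorem integral_ballUniform_norm : ∫ u, ‖u‖ ∂(ballUniform d) = d / (d + 1) := by
  have h := integral_fun_norm_addHaar (volume : Measure (Vec d))
    (fun r => if r ≤ 1 then r else 0)
  have h1 : ∫ x : Vec d, (if ‖x‖ ≤ 1 then ‖x‖ else 0) =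
      ∫ x in Metric.closedBall (0 : Vec d) 1, ‖x‖ := by
    rw [← integral_indicator measurableSet_closedBall]
    exact integral_congr_ae (.of_forall fun x => by simp [Set.indicator])
  have h2 : ∫ y in Set.Ioi (0 : ℝ), y ^ (d - 1) • (if y ≤ 1 then y else 0) = 1 / (d + 1) := by
    have : ∀ y : ℝ, y ^ (d - 1) • (if y ≤ 1 then y else 0)
        = (Set.Iic (1 : ℝ)).indicator (fun y => y ^ d) y := fun y => by
      obtain ⟨n, hn⟩ := Nat.exists_eq_succ_of_ne_zero (NeZero.ne d)
      by_cases hy : y ≤ 1 <;> simp [Set.indicator, hy, hn, pow_succ]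
    simp only [this]
    rw [setIntegral_indicator measurableSet_Iic, Set.Ioi_inter_Iic,
      ← intervalIntegral.integral_of_le zero_le_one, integral_pow]
    simp
  have hv : (volume : Measure (Vec d)).real (Metric.closedBall 0 1) ≠ 0 :=
    (ENNReal.toReal_pos volume_ball_ne_zero volume_ball_ne_top).ne'
  rw [h1, finrank_euclideanSpace_fin, h2, measureReal_def,
    ← Measure.addHaar_unitClosedBall_eq_addHaar_unitBall, ← measureReal_def] at h
  rw [integral_ballUniform, h]
  simp only [nsmul_eq_mul, smul_eq_mul]
  field_simp

end Uniform

/-! ### Bias of the smoothing -/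

namespace IsSmooth

variable {d : ℕ} {L : ℝ} {f : Vec d → ℝ}

theorem hasGradientAt_smoothing (hf : IsSmooth L f) (μ : ℝ) (x : Vec d) :
    HasGradientAt (smoothing μ f) (∫ u, gradient f (x + μ • u) ∂(ballUniform d)) x := by
  have hc := hf.differentiable.continuous
  have h := hasGradientAt_integral (ν := ballUniform d) (G := fun x u => f (x + μ • u))
    (fun u => hf.comp_add_right _) (fun x => integrable_ballUniform (by fun_prop)) x
  simp only [fun u => (hf.hasGradientAt_comp_add_right (μ • u) x).gradient] at h
  exact h

theorem smoothing (hf : IsSmooth L f) (μ : ℝ) : IsSmooth L (smoothing μ f) := by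
  have hc := hf.differentiable.continuous
  exact integral (ν := ballUniform d) (G := fun x u => f (x + μ • u))
    (fun u => hf.comp_add_right _) (fun x => integrable_ballUniform (by fun_prop))

/-- The average of `‖u‖` over the ball is `d/(d + 1)`, which is at most `d/2` because `d ≥ 1`. -/
theorem norm_gradient_smoothing_sub_le [NeZero d] (hf : IsSmooth L f) (hL : 0 ≤ L) {μ : ℝ}
    (hμ : 0 ≤ μ) (x : Vec d) :
    ‖gradient f x - gradient (AccZOM.smoothing μ f) x‖ ≤ L * μ * d / 2 := by
  have hc := hf.continuous_gradient
  rw [(hf.hasGradientAt_smoothing μ x).gradient]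
  have h1 : gradient f x - ∫ u, gradient f (x + μ • u) ∂(ballUniform d)
      = ∫ u, (gradient f x - gradient f (x + μ • u)) ∂(ballUniform d) := by
    rw [integral_sub (integrable_const _) (integrable_ballUniform (by fun_prop))]
    simp
  rw [h1]
  have h2 := norm_integral_le_of_norm_le (μ := ballUniform d) (g := fun u => L * μ * ‖u‖)
    (f := fun u => gradient f x - gradient f (x + μ • u)) (integrable_ballUniform (by fun_prop))
    (.of_forall fun u => by
      refine (hf.norm_gradient_sub_le _ _).trans_eq ?_
      rw [sub_add_cancel_left, norm_neg, norm_smul, Real.norm_of_nonneg hμ, mul_assoc])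
  rw [integral_const_mul, integral_ballUniform_norm] at h2
  refine h2.trans ?_
  have hd : (1 : ℝ) ≤ d := by exact_mod_cast NeZero.one_le
  have : (d : ℝ) / (d + 1) ≤ d / 2 := by gcongr; linarith
  calc L * μ * (d / (d + 1)) ≤ L * μ * (d / 2) := by gcongr
    _ = _ := by ring

/-- The first-order term averages to zero over the ball, so only the quadratic remainder is left. -/
theorem smoothing_le [NeZero d] (hf : IsSmooth L f) (hL : 0 ≤ L) (μ : ℝ) (x : Vec d) :
    AccZOM.smoothing μ f x ≤ f x + L / 2 * μ ^ 2 := by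
  have hc := hf.differentiable.continuous
  have h : AccZOM.smoothing μ f x
      ≤ ∫ u, (f x + L / 2 * μ ^ 2 + μ * inner ℝ u (gradient f x)) ∂(ballUniform d) := by
    refine integral_mono_ae (integrable_ballUniform (by fun_prop))
      (integrable_ballUniform (by fun_prop)) (ae_norm_ballUniform.mono fun u hu => ?_)
    have h1 := (abs_le.1 (hf.abs_sub_sub_inner_le x (μ • u))).2
    rw [inner_smul_right, norm_smul, mul_pow, Real.norm_eq_abs, sq_abs, real_inner_comm] at h1
    have h2 : L / 2 * (μ ^ 2 * ‖u‖ ^ 2) ≤ L / 2 * μ ^ 2 := by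
      have : ‖u‖ ^ 2 ≤ 1 := pow_le_one₀ (norm_nonneg _) hu
      nlinarith [mul_nonneg hL (sq_nonneg μ)]
    simp only
    linarith
  rw [integral_add (integrable_const _) (integrable_ballUniform (by fun_prop)),
    integral_const_mul, integral_ballUniform_inner] at h
  simpa using h

end IsSmooth

theorem le_smoothing {d : ℕ} {f : Vec d → ℝ} (hf : Continuous f) {b : ℝ} (hb : ∀ x, b ≤ f x)
    (μ : ℝ) (x : Vec d) : b ≤ smoothing μ f x := by
  have h := integral_mono (μ := ballUniform d) (integrable_const b)
    (integrable_ballUniform (g := fun u => f (x + μ • u)) (by fun_prop)) fun u => hb _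
  rwa [integral_const, probReal_univ, one_smul] at h

/-! ### Second moments of random vectors -/

section SecondMoment

theorem memLp_two_of_lintegral_sq_le {E Z : Type*} [NormedAddCommGroup E] [MeasurableSpace Z]
    {ν : Measure Z} {W : Z → E} (hW : AEStronglyMeasurable W ν) {b : ℝ}
    (h : ∫⁻ z, ‖W z‖ₑ ^ 2 ∂ν ≤ ENNReal.ofReal b) : MemLp W 2 ν := by
  refine (memLp_two_iff_integrable_sq_norm hW).2 ⟨hW.norm.pow 2, ?_⟩
  rw [hasFiniteIntegral_iff_enorm]
  simpa using h.trans_lt ENNReal.ofReal_lt_top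

theorem integral_sq_norm_le_of_lintegral_le {E Z : Type*} [NormedAddCommGroup E]
    [MeasurableSpace Z] {ν : Measure Z} {W : Z → E} (hW : AEStronglyMeasurable W ν) {b : ℝ}
    (hb : 0 ≤ b) (h : ∫⁻ z, ‖W z‖ₑ ^ 2 ∂ν ≤ ENNReal.ofReal b) : ∫ z, ‖W z‖ ^ 2 ∂ν ≤ b := by
  rw [integral_eq_lintegral_of_nonneg_ae (.of_forall fun z => sq_nonneg _) (hW.norm.pow 2)]
  refine ENNReal.toReal_le_of_le_ofReal hb (le_trans (le_of_eq ?_) h)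
  refine lintegral_congr fun z => ?_
  rw [ENNReal.ofReal_pow (norm_nonneg _), ofReal_norm]

theorem norm_smul_add_smul_sq_le {E : Type*} [NormedAddCommGroup E] [InnerProductSpace ℝ E]
    (a b : ℝ) (x y : E) :
    ‖a • x + b • y‖ ^ 2 ≤ 2 * a ^ 2 * ‖x‖ ^ 2 + 2 * b ^ 2 * ‖y‖ ^ 2 := by
  have h1 := parallelogram_law_with_norm ℝ (a • x) (b • y)
  have h2 : ‖a • x‖ * ‖a • x‖ = a ^ 2 * ‖x‖ ^ 2 := by
    rw [norm_smul, Real.norm_eq_abs, ← sq_abs a]; ring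
  have h3 : ‖b • y‖ * ‖b • y‖ = b ^ 2 * ‖y‖ ^ 2 := by
    rw [norm_smul, Real.norm_eq_abs, ← sq_abs b]; ring
  nlinarith [mul_self_nonneg ‖a • x - b • y‖]

variable {E : Type*} [NormedAddCommGroup E] [InnerProductSpace ℝ E]
  {Z : Type*} [MeasurableSpace Z] {ν : Measure Z} [IsProbabilityMeasure ν] {W X : Z → E}

theorem integrable_inner_of_memLp (hW : MemLp W 2 ν) (c : E) :
    Integrable (fun z => inner ℝ c (W z)) ν :=
  (hW.integrable (by norm_num)).const_inner c

theorem integral_sq_norm_const_add (hW : MemLp W 2 ν) {a : E}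
    (h0 : ∫ z, inner ℝ a (W z) ∂ν = 0) :
    ∫ z, ‖a + W z‖ ^ 2 ∂ν = ‖a‖ ^ 2 + ∫ z, ‖W z‖ ^ 2 ∂ν := by
  have hi := (memLp_two_iff_integrable_sq_norm hW.1).1 hW
  have hj := (integrable_inner_of_memLp hW a).const_mul 2
  have hk : Integrable (fun z => ‖a‖ ^ 2 + 2 * inner ℝ a (W z)) ν := (integrable_const _).add hj
  simp only [norm_add_sq_real]
  rw [integral_add hk hi, integral_add (integrable_const _) hj, integral_const_mul, h0]
  simp

/-- The variance is at most the second moment. -/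
theorem integral_sq_norm_sub_const_le (hX : MemLp X 2 ν) {δ : E}
    (h0 : ∫ z, inner ℝ δ (X z - δ) ∂ν = 0) :
    ∫ z, ‖X z - δ‖ ^ 2 ∂ν ≤ ∫ z, ‖X z‖ ^ 2 ∂ν := by
  have hW : MemLp (fun z => X z - δ) 2 ν := hX.sub (memLp_const δ)
  have h := integral_sq_norm_const_add hW h0
  simp only [add_sub_cancel] at h
  nlinarith [sq_nonneg ‖δ‖]

end SecondMoment

/-! ### The gradient estimator and the momentum error -/

namespace Assumptions

section Component

variable {d : ℕ} {Ξ : Type*} [MeasurableSpace Ξ] {F : Vec d → Ξ → ℝ} {D : Measure Ξ} {L σ μ : ℝ}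

theorem isSmooth_component (A : Assumptions F D L σ μ) (s : Ξ) : IsSmooth L fun x => F x s :=
  ⟨A.differentiable s, A.smooth s⟩

theorem measurable_uncurry (A : Assumptions F D L σ μ) : Measurable (Function.uncurry F) :=
  measurable_uncurry_of_continuous_of_measurable
    (fun s => (A.differentiable s).continuous) A.measurable

theorem measurable_zoGrad (A : Assumptions F D L σ μ) :
    Measurable fun p : Vec d × Ξ × Vec d => (zoGrad F μ p.1 p.2.1 p.2.2).val := by
  have h1 : Measurable fun p : Vec d × Ξ × Vec d => F (p.1 + μ • p.2.2) p.2.1 :=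
    A.measurable_uncurry.comp
      (f := fun p : Vec d × Ξ × Vec d => (p.1 + μ • p.2.2, p.2.1)) (by fun_prop)
  have h2 : Measurable fun p : Vec d × Ξ × Vec d => F p.1 p.2.1 :=
    A.measurable_uncurry.comp (f := fun p : Vec d × Ξ × Vec d => (p.1, p.2.1)) (by fun_prop)
  exact ((h1.sub h2).div_const _).smul (by fun_prop)

theorem measurable_zoGrad_right (A : Assumptions F D L σ μ) (x : Vec d) :
    Measurable fun z : Ξ × Vec d => (zoGrad F μ x z.1 z.2).val :=
  A.measurable_zoGrad.comp (f := fun z : Ξ × Vec d => (x, z)) (by fun_prop)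

/-- The Taylor remainders at `x` and `y` are at most `Lμ²/2` each. The inner product with `u` is
kept, since bounding it by Cauchy–Schwarz would lose the factor `1/d` gained by averaging over the
sphere. -/
theorem norm_zoGrad_sub_zoGrad_sq_le (A : Assumptions F D L σ μ) (hμ : 0 < μ) (x y : Vec d)
    (s : Ξ) {u : Vec d} (hu : ‖u‖ = 1) :
    ‖(zoGrad F μ y s u).val - (zoGrad F μ x s u).val‖ ^ 2
      ≤ 3 * d ^ 2 * inner ℝ (gradient (fun x => F x s) y - gradient (fun x => F x s) x) u ^ 2
        + 3 / 2 * L ^ 2 * d ^ 2 * μ ^ 2 := by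
  have hy := (A.isSmooth_component s).abs_sub_sub_inner_le y (μ • u)
  have hx := (A.isSmooth_component s).abs_sub_sub_inner_le x (μ • u)
  simp only [inner_smul_right, norm_smul, hu, mul_one, Real.norm_eq_abs, sq_abs] at hx hy
  rw [inner_sub_left]
  set a := inner ℝ (gradient (fun x => F x s) y) u
  set b := inner ℝ (gradient (fun x => F x s) x) u
  set r := (F (y + μ • u) s - F y s) - (F (x + μ • u) s - F x s) with hr
  have e : (zoGrad F μ y s u).val - (zoGrad F μ x s u).val = (d / μ * r) • u := by
    simp only [zoGrad, oracle, ← sub_smul, hr]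
    congr 1
    rw [div_div_eq_mul_div, div_div_eq_mul_div]
    ring
  have h1 : |r - μ * (a - b)| ≤ L * μ ^ 2 := by
    rw [abs_le] at *
    constructor <;> linarith [hx.1, hx.2, hy.1, hy.2]
  have h2 : (r - μ * (a - b)) ^ 2 ≤ (L * μ ^ 2) ^ 2 := by
    rw [← sq_abs]; exact pow_le_pow_left₀ (abs_nonneg _) h1 2
  -- With `A = r - μ(a - b)` and `B = μ(a - b)`, this is `(A + B)² ≤ 3B² + 3/2 A²`, equivalent to
  -- `(A - 2B)² ≥ 0`.
  have h3 : r ^ 2 ≤ 3 * μ ^ 2 * (a - b) ^ 2 + 3 / 2 * (L * μ ^ 2) ^ 2 := by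
    nlinarith [sq_nonneg (r - μ * (a - b) - 2 * (μ * (a - b)))]
  rw [e, norm_smul, hu, mul_one, Real.norm_eq_abs, sq_abs, mul_pow, div_pow]
  calc (d : ℝ) ^ 2 / μ ^ 2 * r ^ 2
      ≤ d ^ 2 / μ ^ 2 * (3 * μ ^ 2 * (a - b) ^ 2 + 3 / 2 * (L * μ ^ 2) ^ 2) := by gcongr
    _ = _ := by field_simp

theorem memLp_zoGrad_sub (A : Assumptions F D L σ μ) (x : Vec d) :
    MemLp (fun z => (zoGrad F μ x z.1 z.2).val - gradient (smoothing μ (objective F D)) x) 2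
      (D.prod (sphereUniform d)) :=
  memLp_two_of_lintegral_sq_le
    ((A.measurable_zoGrad_right x).sub_const _).aestronglyMeasurable (A.variance x)

theorem integral_sq_norm_zoGrad_sub_le (A : Assumptions F D L σ μ) (x : Vec d) :
    ∫ z, ‖(zoGrad F μ x z.1 z.2).val - gradient (smoothing μ (objective F D)) x‖ ^ 2
      ∂(D.prod (sphereUniform d)) ≤ σ ^ 2 :=
  integral_sq_norm_le_of_lintegral_le
    ((A.measurable_zoGrad_right x).sub_const _).aestronglyMeasurable (sq_nonneg σ) (A.variance x)

end Component

variable {d : ℕ} {Ξ : Type*} [MeasurableSpace Ξ] {F : Vec d → Ξ → ℝ}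
  {D : Measure Ξ} [IsProbabilityMeasure D] {L σ μ : ℝ}

theorem isSmooth_objective (A : Assumptions F D L σ μ) : IsSmooth L (objective F D) :=
  IsSmooth.integral A.isSmooth_component A.integrable

theorem isSmooth_smoothing (A : Assumptions F D L σ μ) :
    IsSmooth L (smoothing μ (objective F D)) :=
  A.isSmooth_objective.smoothing μ

variable [NeZero d]

theorem memLp_zoGrad (A : Assumptions F D L σ μ) (x : Vec d) :
    MemLp (fun z => (zoGrad F μ x z.1 z.2).val) 2 (D.prod (sphereUniform d)) := by
  refine ((A.memLp_zoGrad_sub x).add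
    (memLp_const (gradient (smoothing μ (objective F D)) x))).ae_eq (.of_forall fun z => ?_)
  exact sub_add_cancel _ _

/-- The estimator is an unbiased estimator of the gradient of the smoothed objective. -/
theorem integral_inner_zoGrad (A : Assumptions F D L σ μ) (hμ : 0 < μ) (x e : Vec d) :
    ∫ z, inner ℝ e (zoGrad F μ x z.1 z.2).val ∂(D.prod (sphereUniform d))
      = inner ℝ e (gradient (smoothing μ (objective F D)) x) := by
  have hf := A.isSmooth_objective
  have hfc := hf.differentiable.continuous
  have hgc := hf.continuous_gradient
  rw [integral_prod_symm _ (integrable_inner_of_memLp (A.memLp_zoGrad x) e)]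
  have h1 : ∀ u, ∫ s, inner ℝ e (zoGrad F μ x s u).val ∂D
      = d / μ * ((objective F D (x + μ • u) - objective F D x) * inner ℝ u e) := fun u => by
    simp only [zoGrad, oracle, inner_smul_right, objective]
    rw [integral_mul_const, integral_div, integral_sub (A.integrable _) (A.integrable _),
      real_inner_comm e u, div_div_eq_mul_div]
    ring
  simp only [h1]
  -- Averaging over the data first leaves a function of `u` alone. Subtracting the constant `f(x)`
  -- does not affect the gradient, and the chain rule factor `μ` cancels the `1/μ` of the estimator.
  have h2 := integral_sphereUniform_mul_inner (d := d)
    (φ := fun u => objective F D (x + μ • u) - objective F D x)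
    (φ' := fun u => μ • gradient (objective F D) (x + μ • u))
    (fun u => by
      have := hf.hasGradientAt_comp_add_smul μ x u
      rw [hasGradientAt_iff_hasFDerivAt] at *
      exact this.sub_const _) (by fun_prop) e
  rw [integral_const_mul, div_mul_eq_mul_div, h2, (hf.hasGradientAt_smoothing μ x).gradient,
    ← integral_inner (integrable_ballUniform (by fun_prop))]
  have h3 : ∀ u, inner ℝ (μ • gradient (objective F D) (x + μ • u)) e
      = μ * inner ℝ e (gradient (objective F D) (x + μ • u)) := fun u => by
    rw [real_inner_smul_left, real_inner_comm]
  simp only [h3, integral_const_mul]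
  field_simp

theorem integral_inner_zoGrad_sub (A : Assumptions F D L σ μ) (hμ : 0 < μ) (x e : Vec d) :
    ∫ z, inner ℝ e ((zoGrad F μ x z.1 z.2).val - gradient (smoothing μ (objective F D)) x)
      ∂(D.prod (sphereUniform d)) = 0 := by
  simp only [inner_sub_right]
  rw [integral_sub (integrable_inner_of_memLp (A.memLp_zoGrad x) e) (integrable_const _),
    A.integral_inner_zoGrad hμ]
  simp

theorem integral_sq_norm_zoGrad_sub_zoGrad_le (A : Assumptions F D L σ μ) (hμ : 0 < μ)
    (x y : Vec d) :
    ∫ z, ‖(zoGrad F μ y z.1 z.2).val - (zoGrad F μ x z.1 z.2).val‖ ^ 2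
      ∂(D.prod (sphereUniform d)) ≤ 3 * d * L ^ 2 * ‖y - x‖ ^ 2 + 3 / 2 * L ^ 2 * d ^ 2 * μ ^ 2 := by
  have hd : (d : ℝ) ≠ 0 := Nat.cast_ne_zero.2 (NeZero.ne d)
  have hm : MemLp (fun z => (zoGrad F μ y z.1 z.2).val - (zoGrad F μ x z.1 z.2).val) 2
      (D.prod (sphereUniform d)) := (A.memLp_zoGrad y).sub (A.memLp_zoGrad x)
  have hi := (memLp_two_iff_integrable_sq_norm hm.1).1 hm
  rw [integral_prod _ hi]
  have h : ∀ s, ∫ u, ‖(zoGrad F μ y s u).val - (zoGrad F μ x s u).val‖ ^ 2 ∂(sphereUniform d)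
      ≤ 3 * d * L ^ 2 * ‖y - x‖ ^ 2 + 3 / 2 * L ^ 2 * d ^ 2 * μ ^ 2 := fun s => by
    set a := gradient (fun x => F x s) y - gradient (fun x => F x s) x
    have ha : ‖a‖ ^ 2 ≤ L ^ 2 * ‖y - x‖ ^ 2 := by
      rw [← mul_pow]; exact pow_le_pow_left₀ (norm_nonneg _) (A.smooth s y x) 2
    have hint : Integrable (fun u => inner ℝ a u ^ 2) (sphereUniform d) := by
      refine Integrable.of_bound (C := ‖a‖ ^ 2) (by fun_prop)
        (ae_norm_sphereUniform.mono fun u hu => ?_)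
      rw [norm_pow]
      refine pow_le_pow_left₀ (norm_nonneg _) ((norm_inner_le_norm _ _).trans_eq ?_) 2
      rw [hu, mul_one]
    calc _ ≤ ∫ u, (3 * d ^ 2 * inner ℝ a u ^ 2 + 3 / 2 * L ^ 2 * d ^ 2 * μ ^ 2)
            ∂(sphereUniform d) :=
          integral_mono_of_nonneg (.of_forall fun u => sq_nonneg _)
            ((hint.const_mul _).add (integrable_const _))
            (ae_norm_sphereUniform.mono fun u hu => A.norm_zoGrad_sub_zoGrad_sq_le hμ x y s hu)
      _ = 3 * d * ‖a‖ ^ 2 + 3 / 2 * L ^ 2 * d ^ 2 * μ ^ 2 := by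
          rw [integral_add (hint.const_mul _) (integrable_const _), integral_const_mul,
            integral_sphereUniform_inner_sq]
          simp only [integral_const, probReal_univ, one_smul]
          field_simp
      _ ≤ _ := by
          have := mul_le_mul_of_nonneg_left ha (by positivity : (0 : ℝ) ≤ 3 * d)
          linarith
  refine (integral_mono hi.integral_prod_left (integrable_const _) h).trans_eq ?_
  simp

/-- One step of the error recursion of the momentum estimator, from a fixed state `(x, v)` to the
next point `y`. -/
theorem integral_sq_norm_momentum_le (A : Assumptions F D L σ μ) (hμ : 0 < μ) (x y v : Vec d)
    (α : ℝ) :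
    Integrable (fun z => ‖(zoGrad F μ y z.1 z.2).val + (1 - α) • (v - (zoGrad F μ x z.1 z.2).val)
      - gradient (smoothing μ (objective F D)) y‖ ^ 2) (D.prod (sphereUniform d)) ∧
    ∫ z, ‖(zoGrad F μ y z.1 z.2).val + (1 - α) • (v - (zoGrad F μ x z.1 z.2).val)
        - gradient (smoothing μ (objective F D)) y‖ ^ 2 ∂(D.prod (sphereUniform d))
      ≤ (1 - α) ^ 2 * ‖v - gradient (smoothing μ (objective F D)) x‖ ^ 2
        + 2 * (1 - α) ^ 2 * (3 * d * L ^ 2 * ‖y - x‖ ^ 2 + 3 / 2 * L ^ 2 * d ^ 2 * μ ^ 2)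
        + 2 * α ^ 2 * σ ^ 2 := by
  set p := D.prod (sphereUniform d)
  set gx := gradient (smoothing μ (objective F D)) x
  set gy := gradient (smoothing μ (objective F D)) y
  set a := (1 - α) • (v - gx)
  set X : Ξ × Vec d → Vec d := fun z => (zoGrad F μ y z.1 z.2).val - (zoGrad F μ x z.1 z.2).val
  set Y : Ξ × Vec d → Vec d := fun z => (zoGrad F μ y z.1 z.2).val - gy
  have hY : MemLp Y 2 p := A.memLp_zoGrad_sub y
  have hX : MemLp X 2 p := (A.memLp_zoGrad y).sub (A.memLp_zoGrad x)
  have hXs : MemLp (fun z => X z - (gy - gx)) 2 p := hX.sub (memLp_const _)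
  have hY0 : ∀ e, ∫ z, inner ℝ e (Y z) ∂p = 0 := A.integral_inner_zoGrad_sub hμ y
  have hX0 : ∀ e, ∫ z, inner ℝ e (X z - (gy - gx)) ∂p = 0 := fun e => by
    have e1 : ∀ z, inner ℝ e (X z - (gy - gx)) = inner ℝ e (Y z)
        - inner ℝ e ((zoGrad F μ x z.1 z.2).val - gx) := fun z => by
      rw [← inner_sub_right]; congr 1; simp only [X, Y]; abel
    simp only [e1]
    rw [integral_sub (integrable_inner_of_memLp hY e)
      (integrable_inner_of_memLp (A.memLp_zoGrad_sub x) e), hY0,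
      A.integral_inner_zoGrad_sub hμ x, sub_zero]
  have hW : MemLp (fun z => α • Y z + (1 - α) • (X z - (gy - gx))) 2 p :=
    (hY.const_smul α).add (hXs.const_smul (1 - α))
  have hW0 : ∫ z, inner ℝ a (α • Y z + (1 - α) • (X z - (gy - gx))) ∂p = 0 := by
    simp only [inner_add_right, inner_smul_right]
    rw [integral_add ((integrable_inner_of_memLp hY _).const_mul _)
      ((integrable_inner_of_memLp hXs _).const_mul _), integral_const_mul, integral_const_mul,
      hY0, hX0]
    simp
  -- The new error is the contracted old error `a` plus noise. The noise has mean zero for a fixed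
  -- state, so no cross term with `a` survives.
  have e : ∀ z, (zoGrad F μ y z.1 z.2).val + (1 - α) • (v - (zoGrad F μ x z.1 z.2).val) - gy
      = a + (α • Y z + (1 - α) • (X z - (gy - gx))) := fun z => by
    simp only [a, X, Y]
    module
  simp only [e]
  have hiW := (memLp_two_iff_integrable_sq_norm hW.1).1 hW
  have hiY := (memLp_two_iff_integrable_sq_norm hY.1).1 hY
  have hiX := (memLp_two_iff_integrable_sq_norm hXs.1).1 hXs
  have hs : MemLp (fun z => a + (α • Y z + (1 - α) • (X z - (gy - gx)))) 2 p :=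
    (memLp_const a).add hW
  refine ⟨(memLp_two_iff_integrable_sq_norm hs.1).1 hs, ?_⟩
  rw [integral_sq_norm_const_add hW hW0]
  have h1 : ‖a‖ ^ 2 = (1 - α) ^ 2 * ‖v - gx‖ ^ 2 := by
    simp only [a]
    rw [norm_smul, mul_pow, Real.norm_eq_abs, sq_abs]
  have h2 : ∫ z, ‖α • Y z + (1 - α) • (X z - (gy - gx))‖ ^ 2 ∂p
      ≤ ∫ z, (2 * α ^ 2 * ‖Y z‖ ^ 2 + 2 * (1 - α) ^ 2 * ‖X z - (gy - gx)‖ ^ 2) ∂p :=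
    integral_mono hiW ((hiY.const_mul _).add (hiX.const_mul _))
      fun z => norm_smul_add_smul_sq_le _ _ _ _
  rw [integral_add (hiY.const_mul _) (hiX.const_mul _), integral_const_mul,
    integral_const_mul] at h2
  have h3 : ∫ z, ‖Y z‖ ^ 2 ∂p ≤ σ ^ 2 := A.integral_sq_norm_zoGrad_sub_le y
  have h4 := (integral_sq_norm_sub_const_le hX (hX0 (gy - gx))).trans
    (A.integral_sq_norm_zoGrad_sub_zoGrad_le hμ x y)
  have h5 := mul_le_mul_of_nonneg_left h3 (by positivity : 0 ≤ 2 * α ^ 2)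
  have h6 := mul_le_mul_of_nonneg_left h4 (by positivity : 0 ≤ 2 * (1 - α) ^ 2)
  linarith

end Assumptions

/-! ### Step sizes and parameter conditions -/

theorem rpow_third_pow_three {x : ℝ} (hx : 0 ≤ x) : (x ^ ((1 : ℝ) / 3)) ^ 3 = x := by
  rw [← Real.rpow_natCast, ← Real.rpow_mul hx]
  norm_num

namespace Admissible

variable {d T : ℕ} {L γ k m c μ : ℝ}

theorem c_pos (h : Admissible d T L γ k m c μ) : 0 < c := by
  have := h.k_pos
  exact lt_of_lt_of_le (by positivity) h.c_ge

theorem two_le_m (h : Admissible d T L γ k m c μ) : 2 ≤ m := (le_max_left _ _).trans h.m_ge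

theorem m_pos (h : Admissible d T L γ k m c μ) : 0 < m := by linarith [h.two_le_m]

theorem add_pos (h : Admissible d T L γ k m c μ) (n : ℕ) : 0 < m + n := by
  have := h.m_pos
  positivity

theorem le_rpow_third (h : Admissible d T L γ k m c μ) (n : ℕ) {a : ℝ} (ha : a ^ 3 ≤ m) :
    a ≤ (m + n) ^ ((1 : ℝ) / 3) := by
  have hp := h.add_pos n
  refine le_of_pow_le_pow_left₀ (n := 3) (by norm_num) (by positivity) ?_
  rw [rpow_third_pow_three hp.le]
  have : (0 : ℝ) ≤ n := by positivity
  linarith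

theorem k_le (h : Admissible d T L γ k m c μ) (n : ℕ) : k ≤ (m + n) ^ ((1 : ℝ) / 3) :=
  h.le_rpow_third n ((le_max_left _ _).trans ((le_max_right _ _).trans h.m_ge))

theorem c_mul_k_le (h : Admissible d T L γ k m c μ) (n : ℕ) :
    c * k ≤ (m + n) ^ ((1 : ℝ) / 3) :=
  h.le_rpow_third n ((le_max_right _ _).trans ((le_max_right _ _).trans h.m_ge))

theorem stepSize_pos (h : Admissible d T L γ k m c μ) (n : ℕ) : 0 < stepSize k m n := by
  have := h.add_pos n
  have := h.k_pos
  rw [stepSize]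
  positivity

theorem stepSize_antitone (h : Admissible d T L γ k m c μ) : Antitone (stepSize k m) := by
  intro i j hij
  have := h.add_pos i
  have := h.k_pos
  rw [stepSize, stepSize]
  gcongr

/-- The numerator `c k²` is `(ck) · k`, and both factors are at most `(m + n)^{1/3}`. This gives `α
≤ 1`, hence `(1 - α)² ≤ 1 - α`. -/
theorem mul_stepSize_sq_le_one (h : Admissible d T L γ k m c μ) (n : ℕ) :
    c * stepSize k m n ^ 2 ≤ 1 := by
  have hp : 0 < (m + n) ^ ((1 : ℝ) / 3) := Real.rpow_pos_of_pos (h.add_pos n) _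
  rw [stepSize, div_pow, mul_div_assoc', div_le_one (by positivity)]
  nlinarith [h.k_le n, h.c_mul_k_le n, h.k_pos]

theorem L_mul_gamma_mul_stepSize_le (h : Admissible d T L γ k m c μ) (hL : 0 < L) (n : ℕ) :
    L * (γ * stepSize k m n) ≤ 1 / 2 := by
  have hk := h.k_pos
  have hm : (0 : ℝ) < m ^ ((1 : ℝ) / 3) := Real.rpow_pos_of_pos h.m_pos _
  have h0 : stepSize k m n ≤ k / m ^ ((1 : ℝ) / 3) := by
    simpa [stepSize] using h.stepSize_antitone (Nat.zero_le n)
  have h1 := h.γ_le.trans (min_le_left _ _)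
  calc L * (γ * stepSize k m n)
      ≤ L * (m ^ ((1 : ℝ) / 3) / (2 * L * k) * (k / m ^ ((1 : ℝ) / 3))) := by
        have := (h.stepSize_pos n).le
        gcongr
    _ = 1 / 2 := by field_simp

theorem gamma_sq_le (h : Admissible d T L γ k m c μ) (hL : 0 < L) :
    6 * d * L ^ 2 * γ ^ 2 ≤ 1 / 4 := by
  rcases Nat.eq_zero_or_pos d with rfl | hd
  · norm_num
  have hd : (0 : ℝ) < d := Nat.cast_pos.2 hd
  have h1 := h.γ_le.trans (min_le_right _ _)
  have h2 : γ ^ 2 ≤ (1 / (2 * √(6 * d) * L)) ^ 2 := pow_le_pow_left₀ h.γ_pos.le h1 2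
  have h3 : (1 / (2 * √(6 * d) * L)) ^ 2 = 1 / (4 * (6 * d) * L ^ 2) := by
    rw [div_pow, mul_pow, mul_pow, Real.sq_sqrt (by positivity)]
    norm_num
  rw [h3] at h2
  calc 6 * d * L ^ 2 * γ ^ 2 ≤ 6 * d * L ^ 2 * (1 / (4 * (6 * d) * L ^ 2)) := by gcongr
    _ = 1 / 4 := by field_simp

/-- The weights `1 / η_n` absorb the contraction factor `1 - c η_{n+1}²`. -/
theorem one_sub_div_stepSize_le (h : Admissible d T L γ k m c μ) (n : ℕ) :
    (1 - c * stepSize k m (n + 1) ^ 2) / stepSize k m (n + 1)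
      ≤ 1 / stepSize k m n - 5 / 4 * stepSize k m (n + 1) := by
  have hk := h.k_pos
  have hη := h.stepSize_pos (n + 1)
  have hmn := h.add_pos n
  have hmn' := h.add_pos (n + 1)
  set p := (m + (n + 1 : ℕ)) ^ ((1 : ℝ) / 3) with hp
  set q := (m + n) ^ ((1 : ℝ) / 3) with hq
  have hp0 : 0 < p := Real.rpow_pos_of_pos hmn' _
  have hq0 : 0 < q := Real.rpow_pos_of_pos hmn _
  have hp3 : p ^ 3 = m + n + 1 := by
    rw [hp, rpow_third_pow_three hmn'.le]; push_cast; ring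
  have hq3 : q ^ 3 = m + n := rpow_third_pow_three hmn.le
  have hm2 : 2 ≤ q ^ 3 := by
    rw [hq3]
    have : (0 : ℝ) ≤ n := by positivity
    linarith [h.two_le_m]
  have hpq : p / 2 ≤ q := by
    refine le_of_pow_le_pow_left₀ (n := 3) (by norm_num) hq0.le ?_
    rw [div_pow, hp3]
    linarith
  have hkp : k ≤ p := h.k_le (n + 1)
  -- From `p³ - q³ = 1`, `p - q = 1/(p² + pq + q²)`; as `q ≥ p/2`, the denominator is at least
  -- `7p²/4`, more than `3p²/2`.
  have hd : p - q ≤ 2 / (3 * p ^ 2) := by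
    rw [le_div_iff₀ (by positivity)]
    have h1 : (p - q) * (p ^ 2 + p * q + q ^ 2) = 1 := by linear_combination hp3 - hq3
    have hpq0 : 0 ≤ p - q := by
      by_contra hneg
      push Not at hneg
      nlinarith [mul_pos hp0 hq0, sq_nonneg p, sq_nonneg q]
    nlinarith [mul_le_mul_of_nonneg_left hpq hp0.le, mul_le_mul hpq hpq (by positivity) hq0.le]
  have hs : stepSize k m (n + 1) = k / p := rfl
  have hs' : stepSize k m n = k / q := rfl
  have e : (1 - c * stepSize k m (n + 1) ^ 2) / stepSize k m (n + 1)
      = p / k - c * stepSize k m (n + 1) := by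
    rw [hs]; field_simp
  have hc := mul_le_mul_of_nonneg_right h.c_ge hη.le
  -- The growth of `1/η` in one iteration. It uses up the `2/(3k³)` in the condition on `c`; the
  -- remaining `5/4` is left as decay.
  have h2 : p / k - q / k ≤ 2 / (3 * k ^ 3) * stepSize k m (n + 1) := by
    rw [← sub_div, div_le_iff₀ hk, hs]
    calc p - q ≤ 2 / (3 * p ^ 2) := hd
      _ ≤ 2 / (3 * (k * p)) := by gcongr; nlinarith
      _ = _ := by field_simp
  rw [e, hs', one_div_div]
  linarith

end Admissible

/-! ### Expected decrease of the Lyapunov function -/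

section Potential

variable {d : ℕ} {Ξ : Type*} [MeasurableSpace Ξ]

/-- The Lyapunov function of the algorithm after `n` iterations. -/
def potential (F : Vec d → Ξ → ℝ) (D : Measure Ξ) (γ k m μ : ℝ) (n : ℕ) (x v : Vec d) : ℝ :=
  smoothing μ (objective F D) x - (⨅ x, objective F D x)
    + 3 / 4 * γ / stepSize k m n * ‖v - gradient (smoothing μ (objective F D)) x‖ ^ 2

/-- The error term of iteration `n + 1` in the descent of the Lyapunov function. -/
def stepError (d : ℕ) (L σ γ k m c μ : ℝ) (n : ℕ) : ℝ :=
  3 / 4 * γ * (3 * L ^ 2 * d ^ 2 * μ ^ 2 / stepSize k m (n + 1)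
    + 2 * c ^ 2 * σ ^ 2 * stepSize k m (n + 1) ^ 3)

theorem Admissible.stepError_nonneg {T : ℕ} {L σ γ k m c μ : ℝ}
    (h : Admissible d T L γ k m c μ) (n : ℕ) : 0 ≤ stepError d L σ γ k m c μ n := by
  have := h.γ_pos
  have := h.stepSize_pos (n + 1)
  rw [stepError]
  positivity

variable {F : Vec d → Ξ → ℝ} {D : Measure Ξ} [IsProbabilityMeasure D] {L σ γ k m c μ : ℝ}

theorem Assumptions.iInf_le_smoothing (A : Assumptions F D L σ μ) (x : Vec d) :
    ⨅ x, objective F D x ≤ smoothing μ (objective F D) x :=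
  le_smoothing A.isSmooth_objective.differentiable.continuous (fun y => ciInf_le A.bddBelow y) μ x

theorem Assumptions.potential_nonneg (A : Assumptions F D L σ μ) {T : ℕ}
    (h : Admissible d T L γ k m c μ) (n : ℕ) (x v : Vec d) :
    0 ≤ potential F D γ k m μ n x v := by
  have := A.iInf_le_smoothing x
  have := h.stepSize_pos n
  have := h.γ_pos
  exact add_nonneg (by linarith) (by positivity)

theorem Assumptions.measurable_potential (A : Assumptions F D L σ μ) (n : ℕ) :
    Measurable fun p : Vec d × Vec d => potential F D γ k m μ n p.1 p.2 := by
  have h1 := A.isSmooth_smoothing.differentiable.continuous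
  have h2 := A.isSmooth_smoothing.continuous_gradient
  refine Continuous.measurable ?_
  simp only [potential]
  fun_prop

variable [NeZero d]

theorem Assumptions.integral_potential_step_le (A : Assumptions F D L σ μ) {T : ℕ}
    (h : Admissible d T L γ k m c μ) (n : ℕ) (st : State d) :
    Integrable (fun z => potential F D γ k m μ (n + 1) (step F γ k m c μ (n + 1) st z.1 z.2).x
      (step F γ k m c μ (n + 1) st z.1 z.2).v) (D.prod (sphereUniform d)) ∧
    ∫ z, potential F D γ k m μ (n + 1) (step F γ k m c μ (n + 1) st z.1 z.2).x
        (step F γ k m c μ (n + 1) st z.1 z.2).v ∂(D.prod (sphereUniform d))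
      + γ * stepSize k m (n + 1) / 2 * ‖gradient (smoothing μ (objective F D)) st.x‖ ^ 2
      ≤ potential F D γ k m μ n st.x st.v + stepError d L σ γ k m c μ n := by
  set η := stepSize k m (n + 1) with hη
  have hη0 : 0 < η := h.stepSize_pos (n + 1)
  have hγ := h.γ_pos
  set x := st.x
  set v := st.v
  set y := x - (γ * η) • v with hy
  obtain ⟨hi, hle⟩ := A.integral_sq_norm_momentum_le h.μ_pos x y v (c * η ^ 2)
  set g := gradient (smoothing μ (objective F D)) x with hg
  set I := ∫ z, ‖(zoGrad F μ y z.1 z.2).val + (1 - c * η ^ 2) • (v - (zoGrad F μ x z.1 z.2).val)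
        - gradient (smoothing μ (objective F D)) y‖ ^ 2 ∂(D.prod (sphereUniform d))
  have hyx : y - x = -((γ * η) • v) := by rw [hy]; abel
  -- Polarisation of `⟨v, g⟩` produces the three squares; `Lγη ≤ 1/2` lets half of the `-γη/2 ‖v‖²`
  -- pay for the quadratic remainder.
  have hdesc : smoothing μ (objective F D) y ≤ smoothing μ (objective F D) x
      + γ * η / 2 * ‖v - g‖ ^ 2 - γ * η / 2 * ‖g‖ ^ 2 - γ * η / 4 * ‖v‖ ^ 2 := by
    have h1 := (abs_le.1 (A.isSmooth_smoothing.abs_sub_sub_inner_le x (y - x))).2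
    have h2 : ‖y - x‖ ^ 2 = (γ * η) ^ 2 * ‖v‖ ^ 2 := by
      rw [hyx, norm_neg, norm_smul, mul_pow, Real.norm_eq_abs, sq_abs]
    have h3 : inner ℝ g (y - x) = -(γ * η * inner ℝ v g) := by
      rw [hyx, inner_neg_right, inner_smul_right, real_inner_comm]
    rw [add_sub_cancel, ← hg, h2, h3] at h1
    have h4 := norm_sub_sq_real v g
    have h5 := mul_le_mul_of_nonneg_right (h.L_mul_gamma_mul_stepSize_le A.L_pos (n + 1))
      (by positivity : 0 ≤ γ * η / 2 * ‖v‖ ^ 2)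
    rw [← hη] at h5
    rw [h4]
    linarith
  have hpot : ∀ z : Ξ × Vec d, potential F D γ k m μ (n + 1)
      (step F γ k m c μ (n + 1) st z.1 z.2).x (step F γ k m c μ (n + 1) st z.1 z.2).v
      = smoothing μ (objective F D) y - (⨅ x, objective F D x)
        + 3 / 4 * γ / η * ‖(zoGrad F μ y z.1 z.2).val
          + (1 - c * η ^ 2) • (v - (zoGrad F μ x z.1 z.2).val)
          - gradient (smoothing μ (objective F D)) y‖ ^ 2 := fun z => rfl
  simp only [hpot]
  refine ⟨(integrable_const _).add (hi.const_mul _), ?_⟩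
  rw [integral_add (integrable_const _) (hi.const_mul _), integral_const_mul, integral_const,
    probReal_univ, one_smul]
  have hV : ‖y - x‖ ^ 2 = γ ^ 2 * η ^ 2 * ‖v‖ ^ 2 := by
    rw [hyx, norm_neg, norm_smul, mul_pow, Real.norm_eq_abs, sq_abs, mul_pow]
  rw [hV] at hle
  set α := c * η ^ 2 with hα
  have hα1 : α ≤ 1 := h.mul_stepSize_sq_le_one (n + 1)
  have hα0 : 0 ≤ α := by have := h.c_pos; positivity
  have hsq : (1 - α) ^ 2 ≤ 1 - α := by nlinarith
  have hcon := h.one_sub_div_stepSize_le n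
  rw [← hη, ← hα] at hcon
  have hG := h.gamma_sq_le A.L_pos
  set e := ‖v - g‖ ^ 2
  set B := 3 / 2 * L ^ 2 * d ^ 2 * μ ^ 2 with hB
  have hB0 : 0 ≤ B := by positivity
  have he0 : 0 ≤ e := sq_nonneg _
  -- The condition `6dL²γ² ≤ 1/4` turns the drift of the iterates into `η‖v‖²/4`, small enough for
  -- the descent to absorb.
  have hI : I / η ≤ (1 / stepSize k m n - 5 / 4 * η) * e
      + 1 / 4 * η * ‖v‖ ^ 2 + 2 * B / η + 2 * c ^ 2 * σ ^ 2 * η ^ 3 := by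
    have h1 : I ≤ (1 - α) * e + 2 * (3 * d * L ^ 2 * (γ ^ 2 * η ^ 2 * ‖v‖ ^ 2) + B)
        + 2 * α ^ 2 * σ ^ 2 := by
      refine hle.trans ?_
      have h2 := mul_le_mul_of_nonneg_right hsq he0
      have h3 : (1 - α) ^ 2 * (3 * d * L ^ 2 * (γ ^ 2 * η ^ 2 * ‖v‖ ^ 2) + B)
          ≤ 1 * (3 * d * L ^ 2 * (γ ^ 2 * η ^ 2 * ‖v‖ ^ 2) + B) := by
        gcongr
        linarith
      linarith
    have h2 : (1 - α) / η * e ≤ (1 / stepSize k m n - 5 / 4 * η) * e :=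
      mul_le_mul_of_nonneg_right hcon he0
    have h3 : 6 * d * L ^ 2 * γ ^ 2 * (η * ‖v‖ ^ 2) ≤ 1 / 4 * (η * ‖v‖ ^ 2) :=
      mul_le_mul_of_nonneg_right hG (by positivity)
    have h4 : I / η ≤ (1 - α) / η * e + 6 * d * L ^ 2 * γ ^ 2 * (η * ‖v‖ ^ 2) + 2 * B / η
        + 2 * c ^ 2 * σ ^ 2 * η ^ 3 := by
      rw [div_le_iff₀ hη0]
      refine h1.trans_eq ?_
      rw [hα]
      field_simp
      ring
    linarith
  have hI' := mul_le_mul_of_nonneg_left hI (by positivity : 0 ≤ 3 / 4 * γ)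
  have e1 : 3 / 4 * γ / η * I = 3 / 4 * γ * (I / η) := by ring
  have e2 : stepError d L σ γ k m c μ n
      = 3 / 4 * γ * (2 * B / η + 2 * c ^ 2 * σ ^ 2 * η ^ 3) := by
    rw [stepError, ← hη, hB]; ring
  have e3 : potential F D γ k m μ n x v = smoothing μ (objective F D) x
      - (⨅ x, objective F D x) + 3 / 4 * γ * (1 / stepSize k m n * e) := by
    rw [potential]; ring
  rw [e1, e2, e3]
  -- The total coefficients are `1/2 - 15/16 = -7/16` for `γηe` and `-1/4 + 3/16 = -1/16` for
  -- `γη‖v‖²`, so both terms can be dropped.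
  have hp1 : 0 ≤ γ * η * e := by positivity
  have hp2 : 0 ≤ γ * η * ‖v‖ ^ 2 := by positivity
  linarith

/-- In extended nonnegative form the descent can be summed along the trajectory before anything is
known about integrability of the iterates. -/
theorem Assumptions.lintegral_potential_step_le (A : Assumptions F D L σ μ) {T : ℕ}
    (h : Admissible d T L γ k m c μ) (n : ℕ) (st : State d) :
    ∫⁻ z, ENNReal.ofReal (potential F D γ k m μ (n + 1)
        (step F γ k m c μ (n + 1) st z.1 z.2).x (step F γ k m c μ (n + 1) st z.1 z.2).v)
        ∂(D.prod (sphereUniform d))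
      + ENNReal.ofReal (γ * stepSize k m (n + 1) / 2)
        * ENNReal.ofReal (‖gradient (smoothing μ (objective F D)) st.x‖ ^ 2)
      ≤ ENNReal.ofReal (potential F D γ k m μ n st.x st.v)
        + ENNReal.ofReal (stepError d L σ γ k m c μ n) := by
  obtain ⟨hi, hle⟩ := A.integral_potential_step_le h n st
  have h1 := h.stepSize_pos (n + 1)
  have h2 := h.γ_pos
  rw [← ofReal_integral_eq_lintegral_ofReal hi (.of_forall fun z => A.potential_nonneg h _ _ _),
    ← ENNReal.ofReal_mul (by positivity),
    ← ENNReal.ofReal_add (integral_nonneg fun z => A.potential_nonneg h _ _ _) (by positivity),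
    ← ENNReal.ofReal_add (A.potential_nonneg h _ _ _) (h.stepError_nonneg n)]
  exact ENNReal.ofReal_le_ofReal hle

theorem Assumptions.lintegral_potential_init_le (A : Assumptions F D L σ μ) {T : ℕ}
    (h : Admissible d T L γ k m c μ) (x₁ : Vec d) :
    ∫⁻ z, ENNReal.ofReal (potential F D γ k m μ 0 (initState F μ x₁ z.1 z.2).x
        (initState F μ x₁ z.1 z.2).v) ∂(D.prod (sphereUniform d))
      ≤ ENNReal.ofReal (smoothing μ (objective F D) x₁ - (⨅ x, objective F D x)
        + 3 / 4 * γ / stepSize k m 0 * σ ^ 2) := by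
  have h1 := h.stepSize_pos 0
  have h2 := h.γ_pos
  have hi := (memLp_two_iff_integrable_sq_norm (A.memLp_zoGrad_sub x₁).1).1 (A.memLp_zoGrad_sub x₁)
  have hpot : ∀ z : Ξ × Vec d, potential F D γ k m μ 0 (initState F μ x₁ z.1 z.2).x
        (initState F μ x₁ z.1 z.2).v
      = smoothing μ (objective F D) x₁ - (⨅ x, objective F D x)
        + 3 / 4 * γ / stepSize k m 0 * ‖(zoGrad F μ x₁ z.1 z.2).val
          - gradient (smoothing μ (objective F D)) x₁‖ ^ 2 := fun z => rfl
  have hint : Integrable (fun z => potential F D γ k m μ 0 (initState F μ x₁ z.1 z.2).x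
      (initState F μ x₁ z.1 z.2).v) (D.prod (sphereUniform d)) := by
    simp only [hpot]
    exact (integrable_const _).add (hi.const_mul _)
  rw [← ofReal_integral_eq_lintegral_ofReal hint
    (.of_forall fun z => A.potential_nonneg h _ _ _)]
  refine ENNReal.ofReal_le_ofReal ?_
  simp only [hpot]
  rw [integral_add (integrable_const _) (hi.const_mul _), integral_const_mul, integral_const,
    probReal_univ, one_smul]
  have := A.integral_sq_norm_zoGrad_sub_le x₁
  gcongr

end Potential

/-! ### The trajectory as a function of independent samples -/

section Trajectory

variable {d : ℕ} {Ξ : Type*}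

/-- Only the samples `1, …, n + 1` enter the state after `n` iterations. Its measurability, and its
independence of sample `n + 2`, rest on this. -/
theorem run_congr (F : Vec d → Ξ → ℝ) (γ k m c μ : ℝ) (x₁ : Vec d) {ξ ξ' : ℕ → Ξ}
    {u u' : ℕ → Vec d} (n : ℕ)
    (h : ∀ i, 1 ≤ i → i ≤ n + 1 → ξ i = ξ' i ∧ u i = u' i) :
    run F γ k m c μ x₁ ξ u n = run F γ k m c μ x₁ ξ' u' n := by
  induction n with
  | zero =>
    obtain ⟨h1, h2⟩ := h 1 le_rfl le_rfl
    simp only [run, h1, h2]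
  | succ n ih =>
    obtain ⟨h1, h2⟩ := h (n + 2) (by omega) (by omega)
    simp only [run, h1, h2, ih fun i hi hi' => h i hi (by omega)]

/-- Two queries at initialization, then two estimators of two queries each per iteration. -/
theorem run_queries (F : Vec d → Ξ → ℝ) (γ k m c μ : ℝ) (x₁ : Vec d) (ξ : ℕ → Ξ)
    (u : ℕ → Vec d) (n : ℕ) : (run F γ k m c μ x₁ ξ u n).queries = 4 * n + 2 := by
  induction n with
  | zero => rfl
  | succ n ih =>
    simp only [run, step, zoGrad, oracle, ih]
    ring

/-- The pair `(x_{n+1}, v_{n+1})` as a function of the sequence of samples. -/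
def pairRun (F : Vec d → Ξ → ℝ) (γ k m c μ : ℝ) (x₁ : Vec d) (n : ℕ) (z : ℕ → Ξ × Vec d) :
    Vec d × Vec d :=
  ((run F γ k m c μ x₁ (fun i => (z i).1) (fun i => (z i).2) n).x,
    (run F γ k m c μ x₁ (fun i => (z i).1) (fun i => (z i).2) n).v)

theorem pairRun_congr (F : Vec d → Ξ → ℝ) (γ k m c μ : ℝ) (x₁ : Vec d) {z z' : ℕ → Ξ × Vec d}
    (n : ℕ) (h : ∀ i, 1 ≤ i → i ≤ n + 1 → z i = z' i) :
    pairRun F γ k m c μ x₁ n z = pairRun F γ k m c μ x₁ n z' := by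
  rw [pairRun, pairRun, run_congr F γ k m c μ x₁ n fun i hi hi' =>
    ⟨congrArg Prod.fst (h i hi hi'), congrArg Prod.snd (h i hi hi')⟩]

variable [MeasurableSpace Ξ] {F : Vec d → Ξ → ℝ} {D : Measure Ξ} {L σ γ k m c μ : ℝ}

/-- One iteration on pairs `(x, v)`. -/
def pairStep (F : Vec d → Ξ → ℝ) (γ k m c μ : ℝ) (t : ℕ) (p : Vec d × Vec d)
    (z : Ξ × Vec d) : Vec d × Vec d :=
  ((step F γ k m c μ t ⟨p.1, p.2, 0⟩ z.1 z.2).x, (step F γ k m c μ t ⟨p.1, p.2, 0⟩ z.1 z.2).v)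

theorem measurable_add_smul_sub {X E : Type*} [MeasurableSpace X] [NormedAddCommGroup E]
    [NormedSpace ℝ E] [MeasurableSpace E] [BorelSpace E] [SecondCountableTopology E]
    {f g h : X → E} (hf : Measurable f) (hg : Measurable g) (hh : Measurable h) (r : ℝ) :
    Measurable fun q => f q + r • (g q - h q) := by
  fun_prop

theorem Assumptions.measurable_pairStep (A : Assumptions F D L σ μ) (t : ℕ) :
    Measurable fun q : (Vec d × Vec d) × Ξ × Vec d => pairStep F γ k m c μ t q.1 q.2 := by
  have hx : Measurable fun q : (Vec d × Vec d) × Ξ × Vec d =>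
      q.1.1 - (γ * stepSize k m t) • q.1.2 := by fun_prop
  have h1 : Measurable fun q : (Vec d × Vec d) × Ξ × Vec d =>
      (zoGrad F μ (q.1.1 - (γ * stepSize k m t) • q.1.2) q.2.1 q.2.2).val :=
    A.measurable_zoGrad.comp (f := fun q : (Vec d × Vec d) × Ξ × Vec d =>
      (q.1.1 - (γ * stepSize k m t) • q.1.2, q.2)) (hx.prodMk measurable_snd)
  have h2 : Measurable fun q : (Vec d × Vec d) × Ξ × Vec d =>
      (zoGrad F μ q.1.1 q.2.1 q.2.2).val :=
    A.measurable_zoGrad.comp (f := fun q : (Vec d × Vec d) × Ξ × Vec d => (q.1.1, q.2))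
      (by fun_prop)
  have h3 : Measurable fun q : (Vec d × Vec d) × Ξ × Vec d => q.1.2 := by fun_prop
  have h4 := measurable_add_smul_sub h1 h3 h2 (1 - c * stepSize k m t ^ 2)
  exact hx.prodMk h4

theorem Assumptions.measurable_pairRun (A : Assumptions F D L σ μ) (x₁ : Vec d) (n : ℕ) :
    Measurable (pairRun F γ k m c μ x₁ n) := by
  induction n with
  | zero =>
    exact measurable_const.prodMk ((A.measurable_zoGrad_right x₁).comp (measurable_pi_apply 1))
  | succ n ih =>
    exact (A.measurable_pairStep (γ := γ) (k := k) (m := m) (c := c) (n + 1)).comp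
      (ih.prodMk (measurable_pi_apply (n + 2)))

/-- Extend a finite family of samples to a sequence, with a default value. -/
def extendFamily {Z : Type*} (s : Set ℕ) [DecidablePred (· ∈ s)] (z₀ : Z) (w : s → Z) (i : ℕ) :
    Z :=
  if h : i ∈ s then w ⟨i, h⟩ else z₀

theorem measurable_extendFamily {Z : Type*} [MeasurableSpace Z] (s : Set ℕ)
    [DecidablePred (· ∈ s)] (z₀ : Z) : Measurable (extendFamily s z₀) := by
  refine measurable_pi_iff.2 fun i => ?_
  by_cases h : i ∈ s
  · simpa only [extendFamily, dif_pos h] using measurable_pi_apply _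
  · simpa only [extendFamily, dif_neg h] using measurable_const

/-- The state after `n` iterations is a measurable function of the samples. -/
theorem Assumptions.exists_pairRun_eq {Ω : Type*} [Nonempty Ω] (A : Assumptions F D L σ μ) (ξ : ℕ → Ω → Ξ)
    (u : ℕ → Ω → Vec d) (x₁ : Vec d) {n T : ℕ} (hn : n ≤ T) :
    ∃ g : (Set.Icc 1 (T + 1) → Ξ × Vec d) → Vec d × Vec d, Measurable g ∧
      ∀ ω, pairRun F γ k m c μ x₁ n (fun i => (ξ i ω, u i ω))
        = g fun t => (ξ t ω, u t ω) := by
  obtain ⟨ω₀⟩ := ‹Nonempty Ω›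
  -- Samples outside `1, …, T + 1` are arbitrary functions of `ω`, so they are replaced by a fixed
  -- value, taken at some point of `Ω`.
  set z₀ := (ξ 1 ω₀, u 1 ω₀)
  refine ⟨fun w => pairRun F γ k m c μ x₁ n (extendFamily (Set.Icc 1 (T + 1)) z₀ w),
    (A.measurable_pairRun x₁ n).comp (measurable_extendFamily _ z₀), fun ω => ?_⟩
  refine pairRun_congr _ _ _ _ _ _ _ n fun i hi hi' => ?_
  rw [extendFamily, dif_pos ⟨hi, by omega⟩]

section Sampling

variable {Ω : Type*} [MeasurableSpace Ω] {P : Measure Ω} {T : ℕ} {ξ : ℕ → Ω → Ξ}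
  {u : ℕ → Ω → Vec d}

theorem Sampling.aemeasurable_samples (S : Sampling D P T ξ u) :
    AEMeasurable (fun ω (t : Set.Icc 1 (T + 1)) => (ξ t ω, u t ω)) P :=
  aemeasurable_pi_lambda _ fun t => (S.hasLaw t t.2).aemeasurable

theorem Sampling.aemeasurable_pairRun [IsProbabilityMeasure P] (S : Sampling D P T ξ u)
    (A : Assumptions F D L σ μ) (x₁ : Vec d) {n : ℕ} (hn : n ≤ T) :
    AEMeasurable (fun ω => pairRun F γ k m c μ x₁ n (fun i => (ξ i ω, u i ω))) P := by
  have : Nonempty Ω := P.nonempty_of_neZero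
  obtain ⟨g, hg, h⟩ := A.exists_pairRun_eq (γ := γ) (k := k) (m := m) (c := c) ξ u x₁ hn
  simp only [h]
  exact hg.comp_aemeasurable S.aemeasurable_samples

/-- The state after `n` iterations is independent of the next sample. -/
theorem Sampling.indepFun_pairRun [IsProbabilityMeasure P] (S : Sampling D P T ξ u)
    (A : Assumptions F D L σ μ) (x₁ : Vec d) {n : ℕ} (hn : n + 1 ≤ T) :
    IndepFun (fun ω => pairRun F γ k m c μ x₁ n (fun i => (ξ i ω, u i ω)))
      (fun ω => (ξ (n + 2) ω, u (n + 2) ω)) P := by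
  obtain ⟨ω₀⟩ : Nonempty Ω := P.nonempty_of_neZero
  set z₀ := (ξ 1 ω₀, u 1 ω₀)
  set I : Set ℕ := Set.Icc 1 (T + 1)
  -- The next sample has index `n + 2 ≤ T + 1`; the set `s` of indices that determine the state
  -- stops at `n + 1`.
  set a : I := ⟨n + 2, by simp [I]; omega⟩
  set s : Finset I := Finset.univ.filter fun i => (i : ℕ) ≤ n + 1
  have hdis : Disjoint s {a} := by simp [s, a]
  have h := S.indep.indepFun_finset₀ s {a} hdis fun t => (S.hasLaw t t.2).aemeasurable
  set ext : (s → Ξ × Vec d) → ℕ → Ξ × Vec d := fun w i =>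
    if h : ∃ hi : i ∈ I, (⟨i, hi⟩ : I) ∈ s then w ⟨⟨i, h.1⟩, h.2⟩ else z₀
  have hext : Measurable ext := by
    refine measurable_pi_iff.2 fun i => ?_
    by_cases h : ∃ hi : i ∈ I, (⟨i, hi⟩ : I) ∈ s
    · simpa only [ext, dif_pos h] using measurable_pi_apply _
    · simpa only [ext, dif_neg h] using measurable_const
  have h2 := h.comp ((A.measurable_pairRun (γ := γ) (k := k) (m := m) (c := c) x₁ n).comp hext)
    (measurable_pi_apply (⟨a, Finset.mem_singleton_self a⟩ : ({a} : Finset I)))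
  convert! h2 using 1
  funext ω
  refine pairRun_congr _ _ _ _ _ _ _ n fun i hi hi' => ?_
  have : ∃ hi : i ∈ I, (⟨i, hi⟩ : I) ∈ s :=
    ⟨⟨hi, by omega⟩, by simp [s, hi']⟩
  simp only [ext, dif_pos this]

variable [IsProbabilityMeasure D] [NeZero d]

/-- Integration against the law of the state and the next, independent, sample. -/
theorem Sampling.lintegral_pairRun_succ [IsProbabilityMeasure P] (S : Sampling D P T ξ u)
    (A : Assumptions F D L σ μ) (x₁ : Vec d) {n : ℕ} (hn : n + 1 ≤ T)
    {φ : Vec d × Vec d → ENNReal} (hφ : Measurable φ) :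
    ∫⁻ ω, φ (pairRun F γ k m c μ x₁ (n + 1) (fun i => (ξ i ω, u i ω))) ∂P
      = ∫⁻ ω, ∫⁻ z, φ (pairStep F γ k m c μ (n + 1)
          (pairRun F γ k m c μ x₁ n (fun i => (ξ i ω, u i ω))) z)
          ∂(D.prod (sphereUniform d)) ∂P := by
  have hs := (S.hasLaw (n + 2) ⟨by omega, by omega⟩)
  have hp := S.aemeasurable_pairRun (γ := γ) (k := k) (m := m) (c := c) A x₁ (n := n) (by omega)
  have hind := (S.indepFun_pairRun (γ := γ) (k := k) (m := m) (c := c) A x₁ hn)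
  have hmap := (indepFun_iff_map_prod_eq_prod_map_map hp hs.aemeasurable).1 hind
  have hm := hφ.comp (A.measurable_pairStep (γ := γ) (k := k) (m := m) (c := c) (n + 1))
  have h1 := lintegral_map' hm.aemeasurable (hp.prodMk hs.aemeasurable)
  have : IsProbabilityMeasure
      (P.map fun ω => pairRun F γ k m c μ x₁ n (fun i => (ξ i ω, u i ω))) :=
    Measure.isProbabilityMeasure_map hp
  rw [hmap, hs.map_eq, lintegral_prod _ hm.aemeasurable,
    lintegral_map' hm.lintegral_prod_right'.aemeasurable hp] at h1
  exact h1.symm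

/-- Summing the descent of the Lyapunov function. -/
theorem Sampling.lintegral_potential_add_sum_le [IsProbabilityMeasure P]
    (S : Sampling D P T ξ u) (A : Assumptions F D L σ μ) {T' : ℕ}
    (h : Admissible d T' L γ k m c μ) (x₁ : Vec d) {N : ℕ} (hN : N ≤ T) :
    ∫⁻ ω, ENNReal.ofReal (potential F D γ k m μ N
        (pairRun F γ k m c μ x₁ N (fun i => (ξ i ω, u i ω))).1
        (pairRun F γ k m c μ x₁ N (fun i => (ξ i ω, u i ω))).2) ∂P
      + ∑ n ∈ Finset.range N, ENNReal.ofReal (γ * stepSize k m (n + 1) / 2)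
        * ∫⁻ ω, ENNReal.ofReal (‖gradient (smoothing μ (objective F D))
          (pairRun F γ k m c μ x₁ n (fun i => (ξ i ω, u i ω))).1‖ ^ 2) ∂P
      ≤ ENNReal.ofReal (smoothing μ (objective F D) x₁ - (⨅ x, objective F D x)
          + 3 / 4 * γ / stepSize k m 0 * σ ^ 2)
        + ∑ n ∈ Finset.range N, ENNReal.ofReal (stepError d L σ γ k m c μ n) := by
  induction N with
  | zero =>
    have hs := S.hasLaw 1 ⟨le_rfl, by omega⟩
    have hm : Measurable fun z : Ξ × Vec d => ENNReal.ofReal (potential F D γ k m μ 0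
        (initState F μ x₁ z.1 z.2).x (initState F μ x₁ z.1 z.2).v) :=
      ((A.measurable_potential 0).comp
        (measurable_const.prodMk (A.measurable_zoGrad_right x₁))).ennreal_ofReal
    have h1 := lintegral_map' (f := fun z : Ξ × Vec d => ENNReal.ofReal (potential F D γ k m μ 0
        (initState F μ x₁ z.1 z.2).x (initState F μ x₁ z.1 z.2).v))
      hm.aemeasurable hs.aemeasurable
    rw [hs.map_eq] at h1
    simp only [Finset.range_zero, Finset.sum_empty, add_zero]
    exact h1.symm.trans_le (A.lintegral_potential_init_le h x₁)
  | succ N ih =>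
    have ih := ih (by omega)
    have hφ := (A.measurable_potential (γ := γ) (k := k) (m := m) (N + 1)).ennreal_ofReal
    rw [S.lintegral_pairRun_succ A x₁ hN hφ, Finset.sum_range_succ, Finset.sum_range_succ,
      add_comm (Finset.sum _ _), ← add_assoc]
    have hp := S.aemeasurable_pairRun (γ := γ) (k := k) (m := m) (c := c) A x₁ (n := N) (by omega)
    have hg : AEMeasurable (fun ω => ENNReal.ofReal (‖gradient (smoothing μ (objective F D))
        (pairRun F γ k m c μ x₁ N (fun i => (ξ i ω, u i ω))).1‖ ^ 2)) P := by
      have h2 := A.isSmooth_smoothing.continuous_gradient.measurable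
      exact ((h2.comp_aemeasurable hp.fst).norm.pow_const 2).ennreal_ofReal
    have hpot : AEMeasurable (fun ω => ENNReal.ofReal (potential F D γ k m μ N
        (pairRun F γ k m c μ x₁ N (fun i => (ξ i ω, u i ω))).1
        (pairRun F γ k m c μ x₁ N (fun i => (ξ i ω, u i ω))).2)) P :=
      (A.measurable_potential N).ennreal_ofReal.comp_aemeasurable hp
    have hstep : ∫⁻ ω, ∫⁻ z, ENNReal.ofReal (potential F D γ k m μ (N + 1)
          (pairStep F γ k m c μ (N + 1)
            (pairRun F γ k m c μ x₁ N (fun i => (ξ i ω, u i ω))) z).1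
          (pairStep F γ k m c μ (N + 1)
            (pairRun F γ k m c μ x₁ N (fun i => (ξ i ω, u i ω))) z).2)
          ∂(D.prod (sphereUniform d)) ∂P
        + ENNReal.ofReal (γ * stepSize k m (N + 1) / 2)
          * ∫⁻ ω, ENNReal.ofReal (‖gradient (smoothing μ (objective F D))
            (pairRun F γ k m c μ x₁ N (fun i => (ξ i ω, u i ω))).1‖ ^ 2) ∂P
        ≤ ∫⁻ ω, ENNReal.ofReal (potential F D γ k m μ N
          (pairRun F γ k m c μ x₁ N (fun i => (ξ i ω, u i ω))).1
          (pairRun F γ k m c μ x₁ N (fun i => (ξ i ω, u i ω))).2) ∂P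
        + ENNReal.ofReal (stepError d L σ γ k m c μ N) := by
      rw [← lintegral_const_mul'' _ hg, ← lintegral_add_right' _ (hg.const_mul _)]
      -- The query counter is set to `0`, since neither the point nor the momentum produced by
      -- `step` depends on it.
      refine (lintegral_mono fun ω => A.lintegral_potential_step_le h N
        ⟨(pairRun F γ k m c μ x₁ N (fun i => (ξ i ω, u i ω))).1,
          (pairRun F γ k m c μ x₁ N (fun i => (ξ i ω, u i ω))).2, 0⟩).trans_eq ?_
      rw [lintegral_add_left' hpot]
      simp
    refine (add_le_add_left hstep _).trans ?_
    rw [add_right_comm, ← add_assoc]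
    exact add_le_add_left ih _

end Sampling

end Trajectory

/-! ### Summing the errors and the convergence bound -/

theorem sum_Icc_one_eq_sum_range (g : ℕ → ℝ) (T : ℕ) :
    ∑ t ∈ Finset.Icc 1 T, g t = ∑ n ∈ Finset.range T, g (n + 1) := by
  induction T with
  | zero => simp
  | succ T ih => rw [Finset.sum_Icc_succ_top (by omega), ih, Finset.sum_range_succ]

/-- By `1 - 1/y ≤ log y` at `y = (m + N + 1)/(m + N)`, each term is at most an increment of the
logarithm. -/
theorem sum_one_div_add_le_log {m : ℝ} (hm : 1 ≤ m) (N : ℕ) :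
    ∑ n ∈ Finset.range N, 1 / (m + (n + 1 : ℕ)) ≤ Real.log (m + N) := by
  induction N with
  | zero => simpa using Real.log_nonneg hm
  | succ N ih =>
    rw [Finset.sum_range_succ]
    have h0 : 0 < m + N := by positivity
    have h1 : 0 < m + (N + 1 : ℕ) := by positivity
    have h := Real.one_sub_inv_le_log_of_pos (div_pos h1 h0)
    rw [Real.log_div h1.ne' h0.ne', inv_div] at h
    have e : 1 - (m + N) / (m + (N + 1 : ℕ)) = 1 / (m + (N + 1 : ℕ)) := by
      field_simp
      push_cast
      ring
    linarith

section Bound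

variable {d : ℕ} {Ξ : Type*} [MeasurableSpace Ξ] {F : Vec d → Ξ → ℝ} {D : Measure Ξ}
  {L σ γ k m c μ : ℝ} {T : ℕ}

theorem Admissible.mul_mu_le (h : Admissible d T L γ k m c μ) :
    d * μ ≤ 1 / (m + T) ^ ((2 : ℝ) / 3) := by
  have hp : 0 < (m + T) ^ ((2 : ℝ) / 3) := Real.rpow_pos_of_pos (h.add_pos T) _
  rcases Nat.eq_zero_or_pos d with rfl | hd
  · simp only [Nat.cast_zero, zero_mul]; positivity
  have hd : (0 : ℝ) < d := Nat.cast_pos.2 hd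
  calc d * μ ≤ d * (1 / (d * (m + T) ^ ((2 : ℝ) / 3))) := by gcongr; exact h.μ_le
    _ = _ := by field_simp

/-- The cubes `η³ = k³/(m + n + 1)` sum to a logarithm. With `d²μ² ≤ (m + T)^{-4/3}` and `1/η ≤ (m +
T)^{1/3}/k`, the `T` smoothing terms total at most `3L²/k`. The prefactor `3/4` yields `9L²/(4k)`
and is dropped from the logarithmic term. -/
theorem Admissible.sum_stepError_le (h : Admissible d T L γ k m c μ) :
    ∑ n ∈ Finset.range T, stepError d L σ γ k m c μ n
      ≤ γ * (9 * L ^ 2 / (4 * k) + 2 * c ^ 2 * σ ^ 2 * k ^ 3 * Real.log (m + T)) := by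
  have hk := h.k_pos
  have hγ := h.γ_pos
  have hmT := h.add_pos T
  set r := (m + T) ^ ((1 : ℝ) / 3)
  have hr : 0 < r := Real.rpow_pos_of_pos hmT _
  have hr3 : r ^ 3 = m + T := rpow_third_pow_three hmT.le
  have hr2 : (m + T) ^ ((2 : ℝ) / 3) = r ^ 2 := by
    rw [← Real.rpow_natCast, ← Real.rpow_mul hmT.le]; norm_num
  have hμ := h.μ_pos
  have hdμ : d ^ 2 * μ ^ 2 ≤ 1 / r ^ 4 := by
    have h1 := h.mul_mu_le
    rw [hr2] at h1
    have := pow_le_pow_left₀ (by positivity) h1 2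
    rw [mul_pow, div_pow, one_pow, ← pow_mul] at this
    exact this
  have h1 : ∀ n ∈ Finset.range T, stepError d L σ γ k m c μ n
      ≤ 3 / 4 * γ * (3 * L ^ 2 * (1 / r ^ 4) * (r / k)
        + 2 * c ^ 2 * σ ^ 2 * k ^ 3 * (1 / (m + (n + 1 : ℕ)))) := fun n hn => by
    have hη := h.stepSize_pos (n + 1)
    have hηT : stepSize k m T ≤ stepSize k m (n + 1) :=
      h.stepSize_antitone (Finset.mem_range.1 hn)
    have hT : stepSize k m T = k / r := rfl
    have e1 : stepSize k m (n + 1) ^ 3 = k ^ 3 * (1 / (m + (n + 1 : ℕ))) := by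
      rw [stepSize, div_pow, rpow_third_pow_three (h.add_pos (n + 1)).le]
      ring
    rw [stepError, e1]
    have e2 : 3 * L ^ 2 * d ^ 2 * μ ^ 2 / stepSize k m (n + 1)
        ≤ 3 * L ^ 2 * (1 / r ^ 4) * (r / k) := by
      have h3 : 1 / stepSize k m (n + 1) ≤ r / k := by
        rw [← one_div_div k r, ← hT]
        exact one_div_le_one_div_of_le (h.stepSize_pos T) hηT
      calc 3 * L ^ 2 * d ^ 2 * μ ^ 2 / stepSize k m (n + 1)
          = 3 * L ^ 2 * (d ^ 2 * μ ^ 2) * (1 / stepSize k m (n + 1)) := by ring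
        _ ≤ _ := by gcongr
    rw [mul_assoc (2 * c ^ 2 * σ ^ 2)]
    gcongr
  refine (Finset.sum_le_sum h1).trans ?_
  rw [← Finset.mul_sum, Finset.sum_add_distrib, Finset.sum_const, Finset.card_range,
    nsmul_eq_mul, ← Finset.mul_sum]
  have hlog := sum_one_div_add_le_log (m := m) (by linarith [h.two_le_m]) T
  have hT : (T : ℝ) ≤ r ^ 3 := by rw [hr3]; linarith [h.m_pos]
  have h2 : T * (3 * L ^ 2 * (1 / r ^ 4) * (r / k)) ≤ 3 * L ^ 2 / k := by
    calc T * (3 * L ^ 2 * (1 / r ^ 4) * (r / k))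
        ≤ r ^ 3 * (3 * L ^ 2 * (1 / r ^ 4) * (r / k)) := by gcongr
      _ = _ := by field_simp
  have hl0 : 0 ≤ Real.log (m + T) :=
    Real.log_nonneg (by have : (0 : ℝ) ≤ T := by positivity
                        linarith [h.two_le_m])
  have h3 : 2 * c ^ 2 * σ ^ 2 * k ^ 3 * ∑ n ∈ Finset.range T, 1 / (m + (n + 1 : ℕ))
      ≤ 2 * c ^ 2 * σ ^ 2 * k ^ 3 * Real.log (m + T) := by gcongr
  have h4 : 0 ≤ 2 * c ^ 2 * σ ^ 2 * k ^ 3 * Real.log (m + T) := by positivity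
  calc _ ≤ 3 / 4 * γ * (3 * L ^ 2 / k + 2 * c ^ 2 * σ ^ 2 * k ^ 3 * Real.log (m + T)) := by
        gcongr
    _ = γ * (9 * L ^ 2 / (4 * k)
        + 3 / 4 * (2 * c ^ 2 * σ ^ 2 * k ^ 3 * Real.log (m + T))) := by ring
    _ ≤ _ := mul_le_mul_of_nonneg_left (by linarith) hγ.le

theorem Admissible.initial_add_sum_stepError_le (h : Admissible d T L γ k m c μ) (x₁ : Vec d) :
    smoothing μ (objective F D) x₁ - (⨅ x, objective F D x)
        + 3 / 4 * γ / stepSize k m 0 * σ ^ 2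
        + ∑ n ∈ Finset.range T, stepError d L σ γ k m c μ n
      ≤ k * γ * boundConst F D L σ γ k m c μ x₁ T := by
  have hk := h.k_pos
  have hγ := h.γ_pos
  have hm : 0 < m ^ ((1 : ℝ) / 3) := Real.rpow_pos_of_pos h.m_pos _
  have h1 := h.sum_stepError_le (σ := σ)
  have h2 : stepSize k m 0 = k / m ^ ((1 : ℝ) / 3) := by simp [stepSize]
  have h3 : 3 / 4 * γ / stepSize k m 0 * σ ^ 2 ≤ γ * (m ^ ((1 : ℝ) / 3) * σ ^ 2 / k) := by
    have : 0 ≤ γ * (m ^ ((1 : ℝ) / 3) * σ ^ 2 / k) := by positivity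
    calc 3 / 4 * γ / stepSize k m 0 * σ ^ 2 = 3 / 4 * (γ * (m ^ ((1 : ℝ) / 3) * σ ^ 2 / k)) := by
          rw [h2]; field_simp
      _ ≤ _ := by linarith
  have e : k * γ * boundConst F D L σ γ k m c μ x₁ T
      = smoothing μ (objective F D) x₁ - (⨅ x, objective F D x)
        + γ * (m ^ ((1 : ℝ) / 3) * σ ^ 2 / k)
        + γ * (9 * L ^ 2 / (4 * k) + 2 * c ^ 2 * σ ^ 2 * k ^ 3 * Real.log (m + T)) := by
    rw [boundConst]
    field_simp
    ring
  rw [e]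
  linarith

variable [IsProbabilityMeasure D]

theorem Assumptions.boundConst_pos (A : Assumptions F D L σ μ)
    (h : Admissible d T L γ k m c μ) (x₁ : Vec d) :
    0 < boundConst F D L σ γ k m c μ x₁ T := by
  have hk := h.k_pos
  have hγ := h.γ_pos
  have hL := A.L_pos
  have hσ := A.σ_pos
  have hm := h.m_pos
  have h1 := sub_nonneg.2 (A.iInf_le_smoothing x₁)
  have hl0 : 0 ≤ Real.log (m + T) :=
    Real.log_nonneg (by have : (0 : ℝ) ≤ T := by positivity
                        linarith [h.two_le_m])
  rw [boundConst]
  positivity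

/-- The square root leaves `(m + T)^{1/6}`, which is subadditive; the `T` part combines with
`T^{-1/2}` to `T^{-1/3}`. -/
theorem sqrt_mul_rpow_div_le {M m : ℝ} (hM : 0 ≤ M) (hm : 0 ≤ m) {T : ℕ} (hT : 1 ≤ T) :
    √(M * (m + T) ^ ((1 : ℝ) / 3) / T)
      ≤ √M * m ^ ((1 : ℝ) / 6) / (T : ℝ) ^ ((1 : ℝ) / 2) + √M / (T : ℝ) ^ ((1 : ℝ) / 3) := by
  have hT0 : (0 : ℝ) < T := by exact_mod_cast hT
  rw [Real.sqrt_div (by positivity), Real.sqrt_mul hM, ← Real.sqrt_eq_rpow (T : ℝ),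
    Real.sqrt_eq_rpow ((m + T) ^ ((1 : ℝ) / 3)), ← Real.rpow_mul (by positivity)]
  have h1 : (m + T) ^ ((1 : ℝ) / 3 * (1 / 2)) ≤ m ^ ((1 : ℝ) / 6) + (T : ℝ) ^ ((1 : ℝ) / 6) := by
    rw [show (1 : ℝ) / 3 * (1 / 2) = 1 / 6 by norm_num]
    exact Real.rpow_add_le_add_rpow hm hT0.le (by norm_num) (by norm_num)
  have h2 : √(T : ℝ) = (T : ℝ) ^ ((1 : ℝ) / 6) * (T : ℝ) ^ ((1 : ℝ) / 3) := by
    rw [← Real.rpow_add hT0, Real.sqrt_eq_rpow]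
    norm_num
  have h3 : (T : ℝ) ^ ((1 : ℝ) / 6) / √(T : ℝ) = 1 / (T : ℝ) ^ ((1 : ℝ) / 3) := by
    rw [h2]; field_simp
  calc √M * (m + T) ^ ((1 : ℝ) / 3 * (1 / 2)) / √(T : ℝ)
      ≤ √M * (m ^ ((1 : ℝ) / 6) + (T : ℝ) ^ ((1 : ℝ) / 6)) / √(T : ℝ) := by gcongr
    _ = √M * m ^ ((1 : ℝ) / 6) / √(T : ℝ) + √M * ((T : ℝ) ^ ((1 : ℝ) / 6) / √(T : ℝ)) := by ring
    _ = _ := by rw [h3]; ring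

variable [NeZero d] {Ω : Type*} [MeasurableSpace Ω] {P : Measure Ω} [IsProbabilityMeasure P]
  {ξ : ℕ → Ω → Ξ} {u : ℕ → Ω → Vec d}

theorem Sampling.sum_integral_sq_norm_gradient_smoothing_le (S : Sampling D P T ξ u)
    (A : Assumptions F D L σ μ) (h : Admissible d T L γ k m c μ) (x₁ : Vec d) :
    (∀ n ∈ Finset.range T, MemLp (fun ω => gradient (smoothing μ (objective F D))
      (pairRun F γ k m c μ x₁ n (fun i => (ξ i ω, u i ω))).1) 2 P) ∧
    ∑ n ∈ Finset.range T, ∫ ω, ‖gradient (smoothing μ (objective F D))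
        (pairRun F γ k m c μ x₁ n (fun i => (ξ i ω, u i ω))).1‖ ^ 2 ∂P
      ≤ 2 * boundConst F D L σ γ k m c μ x₁ T * (m + T) ^ ((1 : ℝ) / 3) := by
  have hk := h.k_pos
  have hγ := h.γ_pos
  set g : ℕ → Ω → Vec d := fun n ω => gradient (smoothing μ (objective F D))
      (pairRun F γ k m c μ x₁ n (fun i => (ξ i ω, u i ω))).1
  have hgm : ∀ n ∈ Finset.range T, AEMeasurable (g n) P := fun n hn =>
    A.isSmooth_smoothing.continuous_gradient.measurable.comp_aemeasurable
      (S.aemeasurable_pairRun A x₁ (Finset.mem_range.1 hn).le).fst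
  have hf0 := sub_nonneg.2 (A.iInf_le_smoothing x₁)
  have hη0 := h.stepSize_pos 0
  have hsum := (le_add_self.trans (S.lintegral_potential_add_sum_le A h x₁ le_rfl))
  rw [← ENNReal.ofReal_sum_of_nonneg fun n _ => h.stepError_nonneg n,
    ← ENNReal.ofReal_add (by positivity) (Finset.sum_nonneg fun n _ => h.stepError_nonneg n)]
    at hsum
  have hK := h.initial_add_sum_stepError_le (F := F) (D := D) (σ := σ) x₁
  have hsum' := hsum.trans (ENNReal.ofReal_le_ofReal hK)
  have hη : ∀ n, 0 < γ * stepSize k m (n + 1) / 2 := fun n => by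
    have := h.stepSize_pos (n + 1)
    positivity
  -- All weights are positive, so a finite weighted sum makes each term finite: square integrability
  -- is a consequence of the descent.
  have hfin : ∀ n ∈ Finset.range T, ∫⁻ ω, ENNReal.ofReal (‖g n ω‖ ^ 2) ∂P < ⊤ := fun n hn => by
    have h1 := (Finset.single_le_sum (f := fun n => ENNReal.ofReal (γ * stepSize k m (n + 1) / 2)
      * ∫⁻ ω, ENNReal.ofReal (‖g n ω‖ ^ 2) ∂P) (fun _ _ => zero_le) hn).trans hsum'
    by_contra hcon
    rw [not_lt, top_le_iff] at hcon
    simp only [hcon] at h1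
    rw [ENNReal.mul_top (ENNReal.ofReal_pos.2 (hη n)).ne'] at h1
    exact absurd h1 (not_le.2 ENNReal.ofReal_lt_top)
  have hmem : ∀ n ∈ Finset.range T, MemLp (g n) 2 P := fun n hn => by
    refine memLp_two_of_lintegral_sq_le (hgm n hn).aestronglyMeasurable
      (b := (∫⁻ ω, ENNReal.ofReal (‖g n ω‖ ^ 2) ∂P).toReal) ?_
    rw [ENNReal.ofReal_toReal (hfin n hn).ne]
    exact le_of_eq (lintegral_congr fun ω => by
      rw [ENNReal.ofReal_pow (norm_nonneg _), ofReal_norm])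
  refine ⟨hmem, ?_⟩
  have hint : ∀ n ∈ Finset.range T, Integrable (fun ω => ‖g n ω‖ ^ 2) P := fun n hn =>
    (memLp_two_iff_integrable_sq_norm (hmem n hn).1).1 (hmem n hn)
  have hreal : ∑ n ∈ Finset.range T, γ * stepSize k m (n + 1) / 2 * ∫ ω, ‖g n ω‖ ^ 2 ∂P
      ≤ k * γ * boundConst F D L σ γ k m c μ x₁ T := by
    have hM := A.boundConst_pos h x₁
    rw [← ENNReal.ofReal_le_ofReal_iff (by positivity), ENNReal.ofReal_sum_of_nonneg
      fun n _ => mul_nonneg (hη n).le (integral_nonneg fun _ => sq_nonneg _)]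
    refine le_trans (le_of_eq (Finset.sum_congr rfl fun n hn => ?_)) hsum'
    rw [ENNReal.ofReal_mul (hη n).le, ofReal_integral_eq_lintegral_ofReal (hint n hn)
      (.of_forall fun _ => sq_nonneg _)]
  -- The step sizes decrease, so every weight is at least the last one.
  have hlow : γ * stepSize k m T / 2 * ∑ n ∈ Finset.range T, ∫ ω, ‖g n ω‖ ^ 2 ∂P
      ≤ k * γ * boundConst F D L σ γ k m c μ x₁ T := by
    refine le_trans ?_ hreal
    rw [Finset.mul_sum]
    refine Finset.sum_le_sum fun n hn => ?_
    have h1 : stepSize k m T ≤ stepSize k m (n + 1) :=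
      h.stepSize_antitone (Finset.mem_range.1 hn)
    have h2 : 0 ≤ ∫ ω, ‖g n ω‖ ^ 2 ∂P := integral_nonneg fun _ => sq_nonneg _
    gcongr
  have hr : 0 < (m + T) ^ ((1 : ℝ) / 3) := Real.rpow_pos_of_pos (h.add_pos T) _
  have hT : stepSize k m T = k / (m + T) ^ ((1 : ℝ) / 3) := rfl
  rw [hT] at hlow
  set s := ∑ n ∈ Finset.range T, ∫ ω, ‖g n ω‖ ^ 2 ∂P
  have e : s = 2 * (m + T) ^ ((1 : ℝ) / 3) / (k * γ)
      * (γ * (k / (m + T) ^ ((1 : ℝ) / 3)) / 2 * s) := by field_simp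
  calc s = _ := e
    _ ≤ 2 * (m + T) ^ ((1 : ℝ) / 3) / (k * γ) * (k * γ * boundConst F D L σ γ k m c μ x₁ T) := by
        gcongr
    _ = _ := by field_simp

/-- The convergence bound for the average gradient norm of the iterates. -/
theorem Sampling.average_norm_gradient_le (S : Sampling D P T ξ u)
    (A : Assumptions F D L σ μ) (h : Admissible d T L γ k m c μ) (hT : 1 ≤ T) (x₁ : Vec d) :
    (∀ t ∈ Finset.Icc 1 T, Integrable (fun ω => ‖gradient (objective F D)
        (iterate F γ k m c μ x₁ (fun i => ξ i ω) (fun i => u i ω) t)‖) P) ∧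
    (1 / (T : ℝ)) * ∑ t ∈ Finset.Icc 1 T, ∫ ω, ‖gradient (objective F D)
        (iterate F γ k m c μ x₁ (fun i => ξ i ω) (fun i => u i ω) t)‖ ∂P
      ≤ √(2 * boundConst F D L σ γ k m c μ x₁ T) * m ^ ((1 : ℝ) / 6) / (T : ℝ) ^ ((1 : ℝ) / 2)
        + √(2 * boundConst F D L σ γ k m c μ x₁ T) / (T : ℝ) ^ ((1 : ℝ) / 3)
        + L / (2 * (m + T) ^ ((2 : ℝ) / 3)) := by
  have hT0 : (0 : ℝ) < T := by exact_mod_cast hT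
  have hL := A.L_pos
  have hM := A.boundConst_pos h x₁
  obtain ⟨hmem, hsum⟩ := S.sum_integral_sq_norm_gradient_smoothing_le A h x₁
  set M := boundConst F D L σ γ k m c μ x₁ T
  set X : ℕ → Ω → Vec d := fun n ω => (pairRun F γ k m c μ x₁ n (fun i => (ξ i ω, u i ω))).1
  have hX : ∀ n ω, iterate F γ k m c μ x₁ (fun i => ξ i ω) (fun i => u i ω) (n + 1) = X n ω :=
    fun n ω => rfl
  set b := L / (2 * (m + T) ^ ((2 : ℝ) / 3))
  have hbias : ∀ x, ‖gradient (objective F D) x‖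
      ≤ ‖gradient (smoothing μ (objective F D)) x‖ + b := fun x => by
    have h1 := A.isSmooth_objective.norm_gradient_smoothing_sub_le hL.le h.μ_pos.le x
    have h2 : L * μ * d / 2 ≤ b := by
      have h3 := h.mul_mu_le
      calc L * μ * d / 2 = L / 2 * (d * μ) := by ring
        _ ≤ L / 2 * (1 / (m + T) ^ ((2 : ℝ) / 3)) := by gcongr
        _ = b := by simp only [b]; field_simp
    have h4 := norm_sub_norm_le (gradient (objective F D) x)
      (gradient (smoothing μ (objective F D)) x)
    linarith
  have hint2 : ∀ n ∈ Finset.range T,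
      Integrable (fun ω => ‖gradient (smoothing μ (objective F D)) (X n ω)‖) P :=
    fun n hn => ((hmem n hn).integrable (by norm_num)).norm
  have hint : ∀ n ∈ Finset.range T,
      Integrable (fun ω => ‖gradient (objective F D) (X n ω)‖) P := fun n hn => by
    refine Integrable.mono' ((hint2 n hn).add (integrable_const b)) ?_ (.of_forall fun ω => ?_)
    · exact (A.isSmooth_objective.continuous_gradient.measurable.comp_aemeasurable
        (S.aemeasurable_pairRun A x₁
          (Finset.mem_range.1 hn).le).fst).aestronglyMeasurable.norm
    · rw [norm_norm]
      exact hbias _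
  refine ⟨fun t ht => ?_, ?_⟩
  · obtain ⟨ht1, htT⟩ := Finset.mem_Icc.1 ht
    obtain ⟨n, rfl⟩ := Nat.exists_eq_add_of_le' ht1
    exact hint n (Finset.mem_range.2 htT)
  rw [sum_Icc_one_eq_sum_range]
  simp only [hX]
  -- `Q` bounds the average second moment. The inequality `a ≤ √Q/2 + a²/(2√Q)`, averaged over `ω`
  -- and over the iterations, then gives `√Q` and replaces Jensen's inequality.
  set Q := 2 * M * (m + T) ^ ((1 : ℝ) / 3) / T
  have hr : 0 < (m + T) ^ ((1 : ℝ) / 3) := Real.rpow_pos_of_pos (h.add_pos T) _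
  have hQ : 0 < Q := by positivity
  have hs : 0 < √Q := Real.sqrt_pos.2 hQ
  have hterm : ∀ n ∈ Finset.range T, ∫ ω, ‖gradient (objective F D) (X n ω)‖ ∂P
      ≤ √Q / 2 + 1 / (2 * √Q)
        * ∫ ω, ‖gradient (smoothing μ (objective F D)) (X n ω)‖ ^ 2 ∂P + b := fun n hn => by
    have hsq := (memLp_two_iff_integrable_sq_norm (hmem n hn).1).1 (hmem n hn)
    have hi : Integrable (fun ω => √Q / 2
        + 1 / (2 * √Q) * ‖gradient (smoothing μ (objective F D)) (X n ω)‖ ^ 2) P :=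
      (integrable_const _).add (hsq.const_mul _)
    have h1 := integral_mono (hint n hn) (hi.add (integrable_const b)) fun ω => by
      refine (hbias (X n ω)).trans (add_le_add_left ?_ b)
      set a := ‖gradient (smoothing μ (objective F D)) (X n ω)‖
      have : √Q / 2 + 1 / (2 * √Q) * a ^ 2 - a = (√Q - a) ^ 2 / (2 * √Q) := by
        field_simp
        ring
      have h2 : 0 ≤ (√Q - a) ^ 2 / (2 * √Q) := by positivity
      linarith
    refine h1.trans_eq ?_
    simp only [Pi.add_apply]
    rw [integral_add hi (integrable_const b), integral_add (integrable_const _) (hsq.const_mul _),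
      integral_const_mul, integral_const, integral_const, probReal_univ, one_smul, one_smul]
  have havg := Finset.sum_le_sum hterm
  rw [Finset.sum_add_distrib, Finset.sum_add_distrib, ← Finset.mul_sum, Finset.sum_const,
    Finset.sum_const, Finset.card_range, nsmul_eq_mul, nsmul_eq_mul] at havg
  have hfinal := sqrt_mul_rpow_div_le (M := 2 * M) (by positivity) h.m_pos.le hT
  refine le_trans ?_ (add_le_add_left hfinal b)
  calc 1 / (T : ℝ) * ∑ n ∈ Finset.range T, ∫ ω, ‖gradient (objective F D) (X n ω)‖ ∂P
      ≤ 1 / (T : ℝ) * (T * (√Q / 2) + 1 / (2 * √Q) * (2 * M * (m + T) ^ ((1 : ℝ) / 3))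
        + T * b) := by
        gcongr
        refine havg.trans ?_
        gcongr
    _ = √Q / 2 + Q / (2 * √Q) + b := by simp only [Q]; field_simp
    _ = √Q + b := by
        have : Q / (2 * √Q) = √Q / 2 := by
          rw [div_eq_div_iff (by positivity) (by norm_num)]
          nlinarith [Real.mul_self_sqrt hQ.le]
        rw [this]; ring

end Bound

/-- The mean of a process at an independent uniform time is the average of its means. -/
theorem integral_uniform_time {Ω : Type*} [MeasurableSpace Ω] {P : Measure Ω}
    [IsProbabilityMeasure P] {T : ℕ} {ζ : Ω → ℕ} {Y : ℕ → Ω → ℝ}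
    (hζ : HasLaw ζ (uniformOn (Set.Icc 1 T)) P)
    (hint : ∀ t ∈ Finset.Icc 1 T, Integrable (Y t) P)
    (hind : ∀ t ∈ Finset.Icc 1 T, IndepFun ζ (Y t) P) :
    Integrable (fun ω => Y (ζ ω) ω) P ∧
      ∫ ω, Y (ζ ω) ω ∂P = (1 / (T : ℝ)) * ∑ t ∈ Finset.Icc 1 T, ∫ ω, Y t ω ∂P := by
  set e : ℕ → ℕ → ℝ := fun t n => if n = t then 1 else 0
  have hem : ∀ t, Measurable (e t) := fun t => measurable_from_top
  have hcoe : Set.Icc 1 T = (Finset.Icc 1 T : Set ℕ) := (Finset.coe_Icc 1 T).symm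
  have hmem : ∀ᵐ ω ∂P, ζ ω ∈ Finset.Icc 1 T := by
    have h1 : ∀ᵐ n ∂(P.map ζ), n ∈ Set.Icc 1 T := by
      rw [hζ.map_eq]
      exact ae_cond_mem (Set.finite_Icc 1 T).measurableSet
    simpa using ae_of_ae_map hζ.aemeasurable h1
  -- Expanding over the events `ζ = t` makes each summand a product of independent factors.
  have heq : (fun ω => Y (ζ ω) ω) =ᵐ[P]
      fun ω => ∑ t ∈ Finset.Icc 1 T, e t (ζ ω) * Y t ω := by
    filter_upwards [hmem] with ω hω
    simp only [e, ite_mul, one_mul, zero_mul]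
    rw [Finset.sum_ite_eq, if_pos hω]
  have hes : ∀ t, AEStronglyMeasurable (fun ω => e t (ζ ω)) P := fun t =>
    ((hem t).comp_aemeasurable hζ.aemeasurable).aestronglyMeasurable
  have hterm : ∀ t ∈ Finset.Icc 1 T, Integrable (fun ω => e t (ζ ω) * Y t ω) P := fun t ht =>
    (hint t ht).bdd_mul (c := 1) (hes t) (.of_forall fun ω => by
      simp only [e]; split_ifs <;> simp)
  have hprob : ∀ t ∈ Finset.Icc 1 T, ∫ ω, e t (ζ ω) ∂P = 1 / T := fun t ht => by
    have h1 := integral_map hζ.aemeasurable (f := e t) (hem t).aestronglyMeasurable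
    rw [hζ.map_eq] at h1
    rw [← h1]
    have h2 : e t = Set.indicator {t} 1 := by
      ext n
      simp [e, Set.indicator]
    rw [h2, integral_indicator_one (measurableSet_singleton t), measureReal_def, hcoe,
      ← Finset.coe_singleton, uniformOn_apply_finset,
      Finset.inter_eq_right.2 (Finset.singleton_subset_iff.2 ht)]
    simp
  refine ⟨(integrable_congr heq).2 (integrable_finsetSum _ hterm), ?_⟩
  rw [integral_congr_ae heq, integral_finsetSum _ hterm, Finset.mul_sum]
  refine Finset.sum_congr rfl fun t ht => ?_
  have h := ((hind t ht).comp (hem t) measurable_id).integral_fun_mul_eq_mul_integral (hes t)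
    (hint t ht).aestronglyMeasurable
  simp only [Function.comp_apply, id] at h
  rw [h, hprob t ht]

/-! ### Choice of the number of iterations and query complexity -/

theorem exists_mul_sq_log_le {K m : ℝ} (hK : 0 < K) (hm : 0 < m) :
    ∃ B : ℝ, 1 ≤ B ∧ K * (6 + Real.log (m + 2 * B)) ^ 2 ≤ B := by
  -- With `6 + log(m + 2B) = log(e^6 (m + 2B))`, the claim follows from `log² x = o(x)`; the
  -- constant makes the left side at most `(m + 2B)/4`, which is below `B` once `B ≥ 1 + m`.
  have h1 := (Real.isLittleO_pow_log_id_atTop (n := 2)).bound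
    (c := 1 / (4 * K * Real.exp 6)) (by positivity)
  have h2 : Filter.Tendsto (fun B : ℝ => Real.exp 6 * (m + 2 * B)) Filter.atTop Filter.atTop :=
    (Filter.tendsto_atTop_add_const_left _ m
      (Filter.tendsto_id.const_mul_atTop two_pos)).const_mul_atTop (Real.exp_pos 6)
  obtain ⟨B, hB, hB1⟩ := ((h2.eventually h1).and (Filter.eventually_ge_atTop (1 + m))).exists
  refine ⟨B, by linarith, ?_⟩
  have hB0 : 0 < m + 2 * B := by linarith
  rw [Real.log_mul (Real.exp_pos 6).ne' hB0.ne', Real.log_exp, Real.norm_of_nonneg (sq_nonneg _),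
    id, Real.norm_of_nonneg (by positivity)] at hB
  calc K * (6 + Real.log (m + 2 * B)) ^ 2
      ≤ K * (1 / (4 * K * Real.exp 6) * (Real.exp 6 * (m + 2 * B))) := by gcongr
    _ = (m + 2 * B) / 4 := by field_simp
    _ ≤ B := by linarith

/-- The number of iterations that makes the convergence bound at most `ε`. -/
theorem exists_iteration_count {K m : ℝ} (hK : 0 < K) (hm : 2 ≤ m) :
    ∃ C : ℝ, 0 < C ∧ ∀ d : ℕ, 1 ≤ d → ∀ ε : ℝ, 0 < ε → ε < 1 → ∃ T : ℕ, 1 ≤ T ∧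
      4 * (T : ℝ) + 2
        ≤ C * (d : ℝ) ^ ((3 : ℝ) / 4) * ε ^ (-3 : ℤ) * Real.log (2 + d / ε) ^ 2 ∧
      K * √(√d * (1 + Real.log (m + T))) / (T : ℝ) ^ ((1 : ℝ) / 3) ≤ ε := by
  obtain ⟨B, hB1, hB⟩ := exists_mul_sq_log_le (K := K ^ 3) (m := m) (by positivity) (by linarith)
  -- `T` will be `⌈B N⌉` with `N = d^{3/4} ε^{-3} ℓ²`. Then `T ≤ 2BN` and `4T + 2 ≤ 6T`, which gives
  -- `12B`.
  refine ⟨12 * B, by positivity, fun d hd ε hε hε1 => ?_⟩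
  have hd1 : (1 : ℝ) ≤ d := by exact_mod_cast hd
  set ℓ := Real.log (2 + d / ε) with hℓ
  set X := 2 + (d : ℝ) / ε with hX
  have hdε : 1 ≤ (d : ℝ) / ε := by rw [le_div_iff₀ hε]; linarith
  have hX3 : 3 ≤ X := by linarith
  have hℓ1 : 1 ≤ ℓ := by
    rw [hℓ, Real.le_log_iff_exp_le (by linarith)]
    linarith [Real.exp_one_lt_d9]
  have hℓX : ℓ ≤ X := (Real.log_le_sub_one_of_pos (by linarith)).trans (by linarith)
  set q := (d : ℝ) ^ ((3 : ℝ) / 4) with hq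
  have hq1 : 1 ≤ q := Real.one_le_rpow hd1 (by norm_num)
  have hqd : q ≤ d ^ 3 := by
    calc q ≤ (d : ℝ) ^ (3 : ℝ) := Real.rpow_le_rpow_of_exponent_le hd1 (by norm_num)
      _ = d ^ 3 := by exact_mod_cast Real.rpow_natCast (d : ℝ) 3
  have hz : ε ^ (-3 : ℤ) = 1 / ε ^ 3 := by
    rw [zpow_neg, one_div]; norm_cast
  have hz1 : 1 ≤ 1 / ε ^ 3 := by
    rw [le_div_iff₀ (by positivity), one_mul]
    exact pow_le_one₀ hε.le hε1.le
  rw [hz]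
  set N := q * (1 / ε ^ 3) * ℓ ^ 2 with hN
  have hN1 : 1 ≤ N := by
    have := one_le_mul_of_one_le_of_one_le hq1 hz1
    exact one_le_mul_of_one_le_of_one_le this (one_le_pow₀ hℓ1)
  -- A crude polynomial bound, which makes `log(m + T)` at most linear in `ℓ`. The exponent `5` plus
  -- the summand `1` is the `6` in `R`.
  have hNX : N ≤ X ^ 5 := by
    calc N ≤ d ^ 3 * (1 / ε ^ 3) * X ^ 2 := by rw [hN]; gcongr
      _ = (d / ε) ^ 3 * X ^ 2 := by rw [div_pow]; ring
      _ ≤ X ^ 3 * X ^ 2 := mul_le_mul_of_nonneg_right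
          (pow_le_pow_left₀ (by linarith) (by linarith) 3) (sq_nonneg X)
      _ = X ^ 5 := by ring
  have hBN : 1 ≤ B * N := one_le_mul_of_one_le_of_one_le hB1 hN1
  set T := ⌈B * N⌉₊
  have hT1 : B * N ≤ T := Nat.le_ceil _
  have hT2 : (T : ℝ) ≤ 2 * B * N := by
    have := (Nat.ceil_lt_add_one (by linarith : 0 ≤ B * N)).le
    linarith
  have hT0 : (1 : ℝ) ≤ T := hBN.trans hT1
  refine ⟨T, by exact_mod_cast hT0, ?_, ?_⟩
  · calc 4 * (T : ℝ) + 2 ≤ 6 * (2 * B * N) := by linarith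
      _ = _ := by rw [hN]; ring
  set R := 6 + Real.log (m + 2 * B) with hR
  have hl0 : 0 ≤ Real.log (m + 2 * B) := Real.log_nonneg (by linarith)
  have hlam : 1 + Real.log (m + T) ≤ R * ℓ := by
    have h1 : m + T ≤ (m + 2 * B) * X ^ 5 := by
      calc m + (T : ℝ) ≤ m * N + 2 * B * N := by nlinarith
        _ = (m + 2 * B) * N := by ring
        _ ≤ _ := by gcongr
    have h2 := Real.log_le_log (by linarith) h1
    rw [Real.log_mul (by linarith) (by positivity), Real.log_pow, ← hℓ] at h2
    push_cast at h2
    rw [hR]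
    nlinarith
  have hR1 : 1 ≤ R := by linarith
  have hs0 : 0 ≤ √(d : ℝ) := Real.sqrt_nonneg _
  have hqs : √(√(d : ℝ)) ^ 3 = q := by
    rw [Real.sqrt_eq_rpow, Real.sqrt_eq_rpow, ← Real.rpow_mul (by positivity),
      ← Real.rpow_natCast, ← Real.rpow_mul (by positivity)]
    norm_num [hq]
  -- Cubing the target gives `R` and `ℓ` the exponent `3/2`; rounding it up to `2` fixes the power
  -- of the logarithm in the query bound.
  have hcube : ∀ x : ℝ, 1 ≤ x → √x ^ 3 ≤ x ^ 2 := fun x hx => by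
    have h1 : 1 ≤ √x := Real.one_le_sqrt.2 hx
    calc √x ^ 3 ≤ √x ^ 4 := pow_le_pow_right₀ h1 (by norm_num)
      _ = (√x ^ 2) ^ 2 := by ring
      _ = x ^ 2 := by rw [Real.sq_sqrt (by linarith)]
  have hTp : (0 : ℝ) < (T : ℝ) ^ ((1 : ℝ) / 3) := Real.rpow_pos_of_pos (by linarith) _
  rw [div_le_iff₀ hTp]
  refine le_of_pow_le_pow_left₀ (n := 3) (by norm_num) (by positivity) ?_
  rw [mul_pow, mul_pow, rpow_third_pow_three (by linarith)]
  calc K ^ 3 * √(√d * (1 + Real.log (m + T))) ^ 3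
      ≤ K ^ 3 * √(√d * (R * ℓ)) ^ 3 := by gcongr
    _ = K ^ 3 * (√(√(d : ℝ)) ^ 3 * √R ^ 3 * √ℓ ^ 3) := by
        rw [Real.sqrt_mul hs0, Real.sqrt_mul (by linarith)]; ring
    _ ≤ K ^ 3 * (q * R ^ 2 * ℓ ^ 2) := by
        rw [hqs]
        have := hcube R hR1
        have := hcube ℓ hℓ1
        gcongr
    _ = K ^ 3 * R ^ 2 * (q * ℓ ^ 2) := by ring
    _ ≤ B * (q * ℓ ^ 2) := by gcongr
    _ = ε ^ 3 * (B * N) := by rw [hN]; field_simp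
    _ ≤ ε ^ 3 * T := by gcongr

section Complexity

variable {d : ℕ} [NeZero d] {Ξ : Type*} [MeasurableSpace Ξ] {F : Vec d → Ξ → ℝ} {D : Measure Ξ}
  [IsProbabilityMeasure D] {L σ γ k m c μ : ℝ} {T : ℕ}

/-- Only `1/γ ≤ √d/a` brings in the dimension. Since `μ ≤ 1`, smoothing raises the initial gap by at
most `L/2`. With `|Δ|` the constant is nonnegative whatever the sign of `Δ`. -/
theorem Assumptions.boundConst_le (A : Assumptions F D L σ μ) (h : Admissible d T L γ k m c μ)
    (hT : 1 ≤ T) {a Δ : ℝ} (ha : 0 < a) (hγa : a / √d ≤ γ) {x₁ : Vec d}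
    (hΔ : objective F D x₁ - (⨅ x, objective F D x) ≤ Δ) :
    boundConst F D L σ γ k m c μ x₁ T
      ≤ ((|Δ| + L / 2) / (k * a) + m ^ ((1 : ℝ) / 3) * σ ^ 2 / k ^ 2 + 9 * L ^ 2 / (4 * k ^ 2)
        + 2 * k ^ 2 * c ^ 2 * σ ^ 2) * (√d * (1 + Real.log (m + T))) := by
  have hk := h.k_pos
  have hγ := h.γ_pos
  have hL := A.L_pos
  have hm := h.m_pos
  have hμ := h.μ_pos
  have hd1 : (1 : ℝ) ≤ d := by exact_mod_cast NeZero.one_le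
  have hT0 : (1 : ℝ) ≤ T := by exact_mod_cast hT
  have hs1 : 1 ≤ √(d : ℝ) := Real.one_le_sqrt.2 hd1
  have hl0 : 0 ≤ Real.log (m + T) := Real.log_nonneg (by linarith)
  set l := Real.log (m + T)
  have hμ1 : μ ≤ 1 := by
    have h1 := h.mul_mu_le
    have h2 : 1 ≤ (m + T) ^ ((2 : ℝ) / 3) := Real.one_le_rpow (by linarith) (by norm_num)
    have h3 : 1 / (m + T) ^ ((2 : ℝ) / 3) ≤ 1 := by
      rw [div_le_one (by linarith)]; exact h2
    nlinarith
  have hsm := A.isSmooth_objective.smoothing_le hL.le μ x₁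
  have hμ2 : L / 2 * μ ^ 2 ≤ L / 2 * 1 := by
    gcongr
    exact pow_le_one₀ hμ.le hμ1
  have h0 : smoothing μ (objective F D) x₁ - (⨅ x, objective F D x) ≤ |Δ| + L / 2 := by
    linarith [le_abs_self Δ]
  have hA : (smoothing μ (objective F D) x₁ - (⨅ x, objective F D x)) / (k * γ)
      ≤ (|Δ| + L / 2) / (k * a) * √d := by
    calc _ ≤ (|Δ| + L / 2) / (k * γ) := by gcongr
      _ ≤ (|Δ| + L / 2) / (k * (a / √d)) := by gcongr
      _ = _ := by field_simp
  have hone : 1 ≤ √(d : ℝ) * (1 + l) := one_le_mul_of_one_le_of_one_le hs1 (by linarith)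
  have hsl : √(d : ℝ) ≤ √d * (1 + l) := le_mul_of_one_le_right (by linarith) (by linarith)
  have hll : l ≤ √d * (1 + l) := by nlinarith
  have e1 : (|Δ| + L / 2) / (k * a) * √d ≤ (|Δ| + L / 2) / (k * a) * (√d * (1 + l)) := by gcongr
  have e2 : m ^ ((1 : ℝ) / 3) * σ ^ 2 / k ^ 2
      ≤ m ^ ((1 : ℝ) / 3) * σ ^ 2 / k ^ 2 * (√d * (1 + l)) :=
    le_mul_of_one_le_right (by positivity) hone
  have e3 : 9 * L ^ 2 / (4 * k ^ 2) ≤ 9 * L ^ 2 / (4 * k ^ 2) * (√d * (1 + l)) :=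
    le_mul_of_one_le_right (by positivity) hone
  have e4 : 2 * k ^ 2 * c ^ 2 * σ ^ 2 * l ≤ 2 * k ^ 2 * c ^ 2 * σ ^ 2 * (√d * (1 + l)) := by
    gcongr
  rw [boundConst]
  linarith

/-- For `T ≥ 1` the terms in `T^{-1/2}` and `(m + T)^{-2/3}` are dominated by `T^{-1/3}`, so one
rate governs the choice of `T`. -/
theorem convergence_bound_le {A₀ M : ℝ} (hL : 0 ≤ L) (hm : 0 ≤ m) (hT : 1 ≤ T)
    {w : ℝ} (hw : 1 ≤ w) (hA₀ : 0 ≤ A₀) (hM : M ≤ A₀ * w) :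
    √(2 * M) * m ^ ((1 : ℝ) / 6) / (T : ℝ) ^ ((1 : ℝ) / 2)
        + √(2 * M) / (T : ℝ) ^ ((1 : ℝ) / 3) + L / (2 * (m + T) ^ ((2 : ℝ) / 3))
      ≤ (√(2 * A₀) * (m ^ ((1 : ℝ) / 6) + 1) + L / 2) * √w / (T : ℝ) ^ ((1 : ℝ) / 3) := by
  have hT1 : (1 : ℝ) ≤ T := by exact_mod_cast hT
  have hr : 0 < (T : ℝ) ^ ((1 : ℝ) / 3) := Real.rpow_pos_of_pos (by linarith) _
  have h1 : √(2 * M) ≤ √(2 * A₀) * √w := by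
    rw [← Real.sqrt_mul (by positivity)]
    exact Real.sqrt_le_sqrt (by linarith)
  have h2 : (T : ℝ) ^ ((1 : ℝ) / 3) ≤ (T : ℝ) ^ ((1 : ℝ) / 2) :=
    Real.rpow_le_rpow_of_exponent_le hT1 (by norm_num)
  have h3 : (T : ℝ) ^ ((1 : ℝ) / 3) ≤ (m + T) ^ ((2 : ℝ) / 3) :=
    (Real.rpow_le_rpow_of_exponent_le hT1 (by norm_num)).trans
      (Real.rpow_le_rpow (by linarith) (by linarith) (by norm_num))
  have hw1 : 1 ≤ √w := Real.one_le_sqrt.2 hw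
  have hm6 : 0 ≤ m ^ ((1 : ℝ) / 6) := Real.rpow_nonneg hm _
  calc _ ≤ √(2 * A₀) * √w * m ^ ((1 : ℝ) / 6) / (T : ℝ) ^ ((1 : ℝ) / 3)
        + √(2 * A₀) * √w / (T : ℝ) ^ ((1 : ℝ) / 3)
        + L * √w / (2 * (T : ℝ) ^ ((1 : ℝ) / 3)) := by
        gcongr
        exact le_mul_of_one_le_right hL hw1
    _ = _ := by field_simp

variable {Ω : Type*} [MeasurableSpace Ω] {P : Measure Ω} [IsProbabilityMeasure P]
  {ξ : ℕ → Ω → Ξ} {u : ℕ → Ω → Vec d}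

/-- The mean gradient norm at the uniformly drawn output is the average over the iterates. -/
theorem Sampling.integral_norm_gradient_output (S : Sampling D P T ξ u)
    (A : Assumptions F D L σ μ) (h : Admissible d T L γ k m c μ) (hT : 1 ≤ T) (x₁ : Vec d)
    {ζ : Ω → ℕ} (hζ : HasLaw ζ (uniformOn (Set.Icc 1 T)) P)
    (hind : IndepFun ζ (fun ω (t : Set.Icc 1 (T + 1)) => (ξ t ω, u t ω)) P) :
    Integrable (fun ω => ‖gradient (objective F D)
        (iterate F γ k m c μ x₁ (fun i => ξ i ω) (fun i => u i ω) (ζ ω))‖) P ∧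
      ∫ ω, ‖gradient (objective F D)
          (iterate F γ k m c μ x₁ (fun i => ξ i ω) (fun i => u i ω) (ζ ω))‖ ∂P
        = (1 / (T : ℝ)) * ∑ t ∈ Finset.Icc 1 T, ∫ ω, ‖gradient (objective F D)
          (iterate F γ k m c μ x₁ (fun i => ξ i ω) (fun i => u i ω) t)‖ ∂P := by
  refine integral_uniform_time (Y := fun t ω => ‖gradient (objective F D)
    (iterate F γ k m c μ x₁ (fun i => ξ i ω) (fun i => u i ω) t)‖) hζ
    (S.average_norm_gradient_le A h hT x₁).1 fun t ht => ?_
  have : Nonempty Ω := P.nonempty_of_neZero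
  obtain ⟨g, hg, hgeq⟩ := A.exists_pairRun_eq (γ := γ) (k := k) (m := m) (c := c) ξ u x₁
    (n := t - 1) (T := T) (by have := (Finset.mem_Icc.1 ht).2; omega)
  have hcomp := hind.comp measurable_id
    ((A.isSmooth_objective.continuous_gradient.measurable.comp hg.fst).norm)
  convert! hcomp using 1
  funext ω
  simp only [Function.comp_apply, ← hgeq]
  rfl

end Complexity

end AccZOM

end

/-- The convergence bound of the unconstrained method, and the query complexity
`Õ(d^{3/4} ε^{-3})` of finding an `ε`-stationary point that follows when `γ` is of order
`1 / √d`. -/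
theorem theorem2 :
    (∀ (d T : ℕ), 1 ≤ d → 1 ≤ T →
      ∀ (Ξ : Type u) [MeasurableSpace Ξ] (D : Measure Ξ) [IsProbabilityMeasure D]
        (Ω : Type v) [MeasurableSpace Ω] (P : Measure Ω) [IsProbabilityMeasure P]
        (F : Vec d → Ξ → ℝ) (L σ γ k m c μ : ℝ) (x₁ : Vec d)
        (ξ : ℕ → Ω → Ξ) (u : ℕ → Ω → Vec d),
      Assumptions F D L σ μ → Admissible d T L γ k m c μ → Sampling D P T ξ u →
      (∀ t ∈ Finset.Icc 1 T, Integrable (fun ω => ‖gradient (objective F D)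
          (iterate F γ k m c μ x₁ (fun i => ξ i ω) (fun i => u i ω) t)‖) P) ∧
      (1 / (T : ℝ)) * ∑ t ∈ Finset.Icc 1 T, ∫ ω, ‖gradient (objective F D)
          (iterate F γ k m c μ x₁ (fun i => ξ i ω) (fun i => u i ω) t)‖ ∂P
        ≤ √(2 * boundConst F D L σ γ k m c μ x₁ T) * m ^ ((1 : ℝ) / 6) / (T : ℝ) ^ ((1 : ℝ) / 2)
          + √(2 * boundConst F D L σ γ k m c μ x₁ T) / (T : ℝ) ^ ((1 : ℝ) / 3)
          + L / (2 * (m + T) ^ ((2 : ℝ) / 3))) ∧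
    (∀ L σ Δ k m c a : ℝ, 0 < L → 0 < σ → 0 < a →
      ∃ C : ℝ, 0 < C ∧ ∃ p : ℕ, ∀ d : ℕ, 1 ≤ d → ∀ ε : ℝ, 0 < ε → ε < 1 → ∃ T : ℕ, 1 ≤ T ∧
      ∀ (Ξ : Type u) [MeasurableSpace Ξ] (D : Measure Ξ) [IsProbabilityMeasure D]
        (Ω : Type v) [MeasurableSpace Ω] (P : Measure Ω) [IsProbabilityMeasure P]
        (F : Vec d → Ξ → ℝ) (γ μ : ℝ) (x₁ : Vec d)
        (ξ : ℕ → Ω → Ξ) (u : ℕ → Ω → Vec d) (ζ : Ω → ℕ),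
      Assumptions F D L σ μ → Admissible d T L γ k m c μ → Sampling D P T ξ u →
      objective F D x₁ - (⨅ x, objective F D x) ≤ Δ → a / √d ≤ γ →
      HasLaw ζ (uniformOn (Set.Icc 1 T)) P →
      IndepFun ζ (fun ω (t : Set.Icc 1 (T + 1)) => (ξ t ω, u t ω)) P →
      (∀ ω, ((run F γ k m c μ x₁ (fun i => ξ i ω) (fun i => u i ω) T).queries : ℝ)
        ≤ C * (d : ℝ) ^ ((3 : ℝ) / 4) * ε ^ (-3 : ℤ) * Real.log (2 + d / ε) ^ p) ∧
      Integrable (fun ω => ‖gradient (objective F D)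
          (iterate F γ k m c μ x₁ (fun i => ξ i ω) (fun i => u i ω) (ζ ω))‖) P ∧
      ∫ ω, ‖gradient (objective F D)
          (iterate F γ k m c μ x₁ (fun i => ξ i ω) (fun i => u i ω) (ζ ω))‖ ∂P ≤ ε) := by
  refine ⟨fun d T hd hT Ξ _ D _ Ω _ P _ F L σ γ k m c μ x₁ ξ u A h S => ?_,
    fun L σ Δ k m c a hL hσ ha => ?_⟩
  · have : NeZero d := ⟨by omega⟩
    exact S.average_norm_gradient_le A h hT x₁
  -- The constants are chosen before the problem is given. Outside this range no parameters are
  -- admissible, and the claim is vacuous.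
  by_cases hkm : 0 < k ∧ 2 ≤ m
  swap
  · exact ⟨1, one_pos, 0, fun d _ ε _ _ => ⟨1, le_rfl,
      fun Ξ _ D _ Ω _ P _ F γ μ x₁ ξ u ζ A h => absurd ⟨h.k_pos, h.two_le_m⟩ hkm⟩⟩
  obtain ⟨hk, hm⟩ := hkm
  -- `A₀` depends neither on `d`, `ε` and `T` nor on the problem instance, so `T` can be fixed in
  -- advance.
  set A₀ := (|Δ| + L / 2) / (k * a) + m ^ ((1 : ℝ) / 3) * σ ^ 2 / k ^ 2 + 9 * L ^ 2 / (4 * k ^ 2)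
    + 2 * k ^ 2 * c ^ 2 * σ ^ 2
  have hA₀ : 0 ≤ A₀ := by positivity
  have hK : 0 < √(2 * A₀) * (m ^ ((1 : ℝ) / 6) + 1) + L / 2 := by positivity
  obtain ⟨C, hC, hcount⟩ := exists_iteration_count hK hm
  refine ⟨C, hC, 2, fun d hd ε hε hε1 => ?_⟩
  obtain ⟨T, hT, hqueries, hbound⟩ := hcount d hd ε hε hε1
  refine ⟨T, hT, fun Ξ _ D _ Ω _ P _ F γ μ x₁ ξ u ζ A h S hΔ hγ hζ hind => ?_⟩
  have : NeZero d := ⟨by omega⟩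
  obtain ⟨hint, hmean⟩ := S.integral_norm_gradient_output A h hT x₁ hζ hind
  refine ⟨fun ω => ?_, hint, ?_⟩
  · rw [run_queries]
    push_cast
    exact hqueries
  rw [hmean]
  refine (S.average_norm_gradient_le A h hT x₁).2.trans (le_trans ?_ hbound)
  have hd1 : (1 : ℝ) ≤ d := by exact_mod_cast hd
  have hT0 : (1 : ℝ) ≤ T := by exact_mod_cast hT
  refine convergence_bound_le hL.le (by linarith) hT ?_ hA₀ (A.boundConst_le h hT ha hγ hΔ)
  refine one_le_mul_of_one_le_of_one_le (Real.one_le_sqrt.2 hd1) ?_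
  have := Real.log_nonneg (by linarith : (1 : ℝ) ≤ m + T)
  linarith
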